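/- A \emph{d-identity} of a group $G$ is a formula $(f_1=1)\vee\dots\vee(f_m=1)$, where $f_1,\dots,f_m$ are group words in variables $x_0,x_1,x_2,\dots$, such that for every substitution of elements of $G$ for the variables at least one of the equations $f_k=1$ holds; an equation $f=g$ stands for $fg^{-1}=1$. A set $\Delta$ of d-identities of $G$ is a \emph{basis of d-identities of $G$} if every group that satisfies all formulas of $\Delta$ satisfies all d-identities of $G$. For words $f,g$ write $f\in\langle g\rangle$ for $(f=1)\vee(f=g)\vee(f=g^2)\vee(f=g^3)$, and let $$\theta(y_1,y_2,y_3)=\Big[\bigvee_{i\ne j} y_i\in\langle y_j\rangle\Big]\vee\Big[\bigvee_{\sigma\in S_3}y_{\sigma(1)}\in\langle y_{\sigma(2)}y_{\sigma(3)}\rangle\Big]\vee\Big[\bigvee_{\sigma\in S_3}y_{\sigma(1)}y_{\sigma(2)}\in\langle y_{\sigma(2)}y_{\sigma(3)}\rangle\Big].$$ Theorem 2. The following eight formulas form a basis of d-identities of the symmetric group $S_5$: 1. $\omega_{120}=\bigvee_{0\le i<j\le 120}(x_i=x_j)$; 2. $(x^4=1)\vee(x^5=1)\vee(x^6=1)$;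 3. $(x_1^{30}=1)\vee(x_2^{30}=1)\vee((x_1x_2)^{15}=1)\vee((x_1x_2^2)^{15}=1)\vee((x_1x_2^3)^{15}=1)$; 4. with $y_i=x_i^{15}$ and indices $i,j,k\in\{1,2,3\}$, $$\theta(y_1,y_2,y_3)\vee\Big[\bigvee_i y_i=1\Big]\vee\Big[\bigvee_{i\ne j}(y_iy_j)^{15}=1\Big]\vee\Big[\bigvee_{j\ne i\ne k}(y_iy_jy_k)^{15}=1\Big]\vee\Big[\bigvee_{j\ne i\ne k}(y_iy_jy_ky_j)^{15}=1\Big],$$ where $j\ne i\ne k$ means $j\ne i$ and $i\ne k$ (with $j=k$ allowed); 5. $(x_1^{20}=1)\vee(x_2^{20}=1)\vee(x_1^2=x_2^2)\vee((x_1^2x_2^2)^{10}=1)\vee((x_1^4x_2^2)^2=1)$; 6. $(x_1^{15}=1)\vee(x_2^{15}=1)\vee(x_1^4=1)\vee(x_2^4=1)\vee((x_1x_2)^{15}=1)\vee((x_1x_2)^4=1)$; 7. $(x_1^{10}=1)\vee(x_2^{10}=1)\vee(x_1^4=x_2^4)\vee(x_1^6=x_2^6)\vee((x_1^2x_2^2)^3=1)\vee((x_1^2x_2^2)^4=1)\vee((x_1^2x_2^2)^5=1)$;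 8. $(x_1^{12}=1)\vee(x_2^{12}=1)\vee((x_1x_2)^{12}=1)\vee((x_1x_2^2)^{12}=1)\vee((x_1x_2^3)^{12}=1)\vee((x_1x_2^4)^{12}=1)$. -/

import Mathlib

universe u v

namespace DisjunctiveIdentity

/-- Words in the variables `x₀, x₁, x₂, …`: elements of the free group of countable rank. -/
abbrev Word : Type := FreeGroup ℕ

/-- The finite set `{f₁, …, fₘ}` of words stands for the universally quantified disjunction
`∀ x₀ x₁ …, (f₁ = 1) ∨ … ∨ (fₘ = 1)`. -/
abbrev DFormula : Type := Finset Word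

/-- `δ` is a d-identity of `G`: for every substitution of elements of `G` for the variables,
one of the equations `f = 1` with `f ∈ δ` holds. -/
def Satisfies (G : Type u) [Group G] (δ : DFormula) : Prop :=
  ∀ a : ℕ → G, ∃ f ∈ δ, FreeGroup.lift a f = 1

/-- `H` belongs to the d-variety generated by `G`: every d-identity of `G` is one of `H`. -/
def InDVar (G : Type u) [Group G] (H : Type v) [Group H] : Prop :=
  ∀ δ : DFormula, Satisfies G δ → Satisfies H δ

/-- `Δ` is a basis of d-identities of `G`: it consists of d-identities of `G`, and every group
satisfying all of them belongs to the d-variety generated by `G`. -/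
def IsBasisOfDIdentities (G : Type u) [Group G] (Δ : Set DFormula) : Prop :=
  (∀ δ ∈ Δ, Satisfies G δ) ∧
    ∀ (H : Type v) [Group H], (∀ δ ∈ Δ, Satisfies H δ) → InDVar G H

/-- The variable `xᵢ`. -/
def x (i : ℕ) : Word := FreeGroup.of i

/-- The equation `f = g`, written as `f g⁻¹ = 1`. -/
def eqn (f g : Word) : Word := f * g⁻¹

/-- `⋁_{0 ≤ i < j ≤ n} (xᵢ = xⱼ)`. -/
def omega (n : ℕ) : DFormula :=
  ((Finset.range (n + 1) ×ˢ Finset.range (n + 1)).filter fun p => p.1 < p.2).image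
    fun p => eqn (x p.1) (x p.2)

/-- `f ∈ ⟨g⟩` as an abbreviation of `(f = 1) ∨ (f = g) ∨ (f = g²) ∨ (f = g³)`. -/
def memCyc (f g : Word) : DFormula :=
  {f, eqn f g, eqn f (g ^ 2), eqn f (g ^ 3)}

/-- `θ(y₁, y₂, y₃)`, the disjunction of `yᵢ ∈ ⟨yⱼ⟩` for `i ≠ j`, and of
`y_{σ1} ∈ ⟨y_{σ2} y_{σ3}⟩` and `y_{σ1} y_{σ2} ∈ ⟨y_{σ2} y_{σ3}⟩` for `σ ∈ S₃`. -/
def theta (y : Fin 3 → Word) : DFormula :=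
  ((Finset.univ : Finset (Fin 3 × Fin 3)).filter fun p => p.1 ≠ p.2).biUnion
      (fun p => memCyc (y p.1) (y p.2)) ∪
    (Finset.univ : Finset (Equiv.Perm (Fin 3))).biUnion
      (fun σ => memCyc (y (σ 0)) (y (σ 1) * y (σ 2))) ∪
    (Finset.univ : Finset (Equiv.Perm (Fin 3))).biUnion
      (fun σ => memCyc (y (σ 0) * y (σ 1)) (y (σ 1) * y (σ 2)))

/-- `(x⁴ = 1) ∨ (x⁵ = 1) ∨ (x⁶ = 1)`. -/
def exponents456 : DFormula :=
  {x 1 ^ 4, x 1 ^ 5, x 1 ^ 6}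

/-- `(x₁³⁰ = 1) ∨ (x₂³⁰ = 1) ∨ ((x₁x₂)¹⁵ = 1) ∨ ((x₁x₂²)¹⁵ = 1) ∨ ((x₁x₂³)¹⁵ = 1)`. -/
def fourCycles : DFormula :=
  {x 1 ^ 30, x 2 ^ 30, (x 1 * x 2) ^ 15, (x 1 * x 2 ^ 2) ^ 15, (x 1 * x 2 ^ 3) ^ 15}

/-- With `yᵢ = xᵢ¹⁵` for `i = 1, 2, 3`, the disjunction of `θ(y₁, y₂, y₃)`, of `yᵢ = 1`, of
`(yᵢyⱼ)¹⁵ = 1` for `i ≠ j`, and of `(yᵢyⱼyₖ)¹⁵ = 1` and `(yᵢyⱼyₖyⱼ)¹⁵ = 1` for `j ≠ i ≠ k`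
(where `j = k` is allowed). -/
def elementaryAbelian8 : DFormula :=
  let y : Fin 3 → Word := fun i => x (i.val + 1) ^ 15
  let triples : Finset (Fin 3 × Fin 3 × Fin 3) :=
    Finset.univ.filter fun t => t.2.1 ≠ t.1 ∧ t.1 ≠ t.2.2
  theta y ∪
    Finset.univ.image y ∪
    ((Finset.univ : Finset (Fin 3 × Fin 3)).filter fun p => p.1 ≠ p.2).image
      (fun p => (y p.1 * y p.2) ^ 15) ∪
    triples.image (fun t => (y t.1 * y t.2.1 * y t.2.2) ^ 15) ∪
    triples.image (fun t => (y t.1 * y t.2.1 * y t.2.2 * y t.2.1) ^ 15)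

/-- `(x₁²⁰ = 1) ∨ (x₂²⁰ = 1) ∨ (x₁² = x₂²) ∨ ((x₁²x₂²)¹⁰ = 1) ∨ ((x₁⁴x₂²)² = 1)`. -/
def order9 : DFormula :=
  {x 1 ^ 20, x 2 ^ 20, eqn (x 1 ^ 2) (x 2 ^ 2), (x 1 ^ 2 * x 2 ^ 2) ^ 10,
    (x 1 ^ 4 * x 2 ^ 2) ^ 2}

/-- `(x₁¹⁵ = 1) ∨ (x₂¹⁵ = 1) ∨ (x₁⁴ = 1) ∨ (x₂⁴ = 1) ∨ ((x₁x₂)¹⁵ = 1) ∨ ((x₁x₂)⁴ = 1)`. -/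
def abelian12 : DFormula :=
  {x 1 ^ 15, x 2 ^ 15, x 1 ^ 4, x 2 ^ 4, (x 1 * x 2) ^ 15, (x 1 * x 2) ^ 4}

/-- `(x₁¹⁰ = 1) ∨ (x₂¹⁰ = 1) ∨ (x₁⁴ = x₂⁴) ∨ (x₁⁶ = x₂⁶) ∨ ((x₁²x₂²)³ = 1)
∨ ((x₁²x₂²)⁴ = 1) ∨ ((x₁²x₂²)⁵ = 1)`. -/
def dicyclic12 : DFormula :=
  {x 1 ^ 10, x 2 ^ 10, eqn (x 1 ^ 4) (x 2 ^ 4), eqn (x 1 ^ 6) (x 2 ^ 6),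
    (x 1 ^ 2 * x 2 ^ 2) ^ 3, (x 1 ^ 2 * x 2 ^ 2) ^ 4, (x 1 ^ 2 * x 2 ^ 2) ^ 5}

/-- `(x₁¹² = 1) ∨ (x₂¹² = 1) ∨ ((x₁x₂)¹² = 1) ∨ ((x₁x₂²)¹² = 1) ∨ ((x₁x₂³)¹² = 1)
∨ ((x₁x₂⁴)¹² = 1)`. -/
def order25 : DFormula :=
  {x 1 ^ 12, x 2 ^ 12, (x 1 * x 2) ^ 12, (x 1 * x 2 ^ 2) ^ 12, (x 1 * x 2 ^ 3) ^ 12,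
    (x 1 * x 2 ^ 4) ^ 12}

end DisjunctiveIdentity

/-!
A group satisfying formula 1 is finite, and the class of groups satisfying a d-identity is closed
under subgroups, so it suffices to embed every finite group `G` satisfying formulas 2–8 into `S₅`.
In a Sylow subgroup formula 2 bounds the exponent, and formulas 3 and 4, 5 and 8 then bound the
order by 8, 3 and 5; hence `|G|` divides 120.

If 5 divides `|G|`, a Sylow 5-subgroup is its own centralizer, so its normalizer has order dividing
20 and index 1 or 6. In the first case `G` acts faithfully on the cosets of a Sylow 2-subgroup. In
the second, a normal complement rules out order 30, and the action on the six Sylow 5-subgroups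
embeds `G` into `A₆` or `S₆` with index 6. The cosets of its image form another set of six points,
on which `G` fixes a point, and so `G` embeds into `S₅`.

If `|G|` divides 24, formulas 6 and 7 exclude the centralizers that `S₅` does not have, and `G`
acts faithfully on a union of at most two coset spaces with at most five points in total.
-/

namespace DisjunctiveIdentity

open Equiv

/-! ### Substituting group elements into the formulas -/

section Substitution

variable {G : Type*} [Group G]

theorem lift_x (a : ℕ → G) (i : ℕ) : FreeGroup.lift a (x i) = a i :=
  FreeGroup.lift_apply_of

theorem lift_eqn (a : ℕ → G) (f g : Word) :
    FreeGroup.lift a (eqn f g) = 1 ↔ FreeGroup.lift a f = FreeGroup.lift a g := by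
  rw [eqn, map_mul, map_inv, mul_inv_eq_one]

theorem Satisfies.of_injective {H : Type*} [Group H] {δ : DFormula} (hG : Satisfies G δ)
    {φ : H →* G} (hφ : Function.Injective φ) : Satisfies H δ := by
  intro a
  obtain ⟨f, hf, e⟩ := hG (φ ∘ a)
  refine ⟨f, hf, hφ ?_⟩
  rw [map_one, ← e]
  exact DFunLike.congr_fun
    (FreeGroup.ext_hom _ _ fun i => by simp : φ.comp (FreeGroup.lift a) = _) f

theorem exists_mem_omega (n : ℕ) (a : ℕ → G) :
    (∃ f ∈ omega n, FreeGroup.lift a f = 1) ↔ ∃ i j, i < j ∧ j ≤ n ∧ a i = a j := by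
  simp only [omega, Finset.mem_image, Finset.mem_filter, Finset.mem_product, Finset.mem_range,
    Prod.exists, Nat.lt_succ_iff]
  constructor
  · rintro ⟨f, ⟨i, j, ⟨⟨-, hj⟩, hij⟩, rfl⟩, e⟩
    rw [lift_eqn, lift_x, lift_x] at e
    exact ⟨i, j, hij, hj, e⟩
  · rintro ⟨i, j, hij, hj, e⟩
    refine ⟨_, ⟨i, j, ⟨⟨hij.le.trans hj, hj⟩, hij⟩, rfl⟩, ?_⟩
    rw [lift_eqn, lift_x, lift_x, e]

theorem satisfies_omega_of_card_le [Finite G] {n : ℕ} (h : Nat.card G ≤ n) :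
    Satisfies G (omega n) := by
  intro a
  rw [exists_mem_omega]
  obtain ⟨i, j, e, hij⟩ : ∃ i j : Fin (n + 1), a i = a j ∧ i ≠ j :=
    Function.not_injective_iff.1 fun hinj => by
      simpa using (Nat.card_le_card_of_injective _ hinj).trans h
  rcases lt_or_gt_of_ne hij with hij | hij
  · exact ⟨i, j, hij, Nat.lt_succ_iff.1 j.isLt, e⟩
  · exact ⟨j, i, hij, Nat.lt_succ_iff.1 i.isLt, e.symm⟩

theorem Satisfies.finite_of_omega {n : ℕ} (h : Satisfies G (omega n)) : Finite G := by
  by_contra hinf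
  rw [not_finite_iff_infinite] at hinf
  obtain ⟨i, j, hij, -, e⟩ := (exists_mem_omega n _).1 (h (Infinite.natEmbedding G))
  exact hij.ne ((Infinite.natEmbedding G).injective e)

theorem exists_mem_exponents456 (a : ℕ → G) :
    (∃ f ∈ exponents456, FreeGroup.lift a f = 1) ↔ a 1 ^ 4 = 1 ∨ a 1 ^ 5 = 1 ∨ a 1 ^ 6 = 1 := by
  simp only [exponents456, Finset.mem_insert, Finset.mem_singleton, exists_eq_or_imp,
    exists_eq_left, map_pow, lift_x]

theorem exists_mem_fourCycles (a : ℕ → G) :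
    (∃ f ∈ fourCycles, FreeGroup.lift a f = 1) ↔
      a 1 ^ 30 = 1 ∨ a 2 ^ 30 = 1 ∨ (a 1 * a 2) ^ 15 = 1 ∨ (a 1 * a 2 ^ 2) ^ 15 = 1 ∨
      (a 1 * a 2 ^ 3) ^ 15 = 1 := by
  simp only [fourCycles, Finset.mem_insert, Finset.mem_singleton, exists_eq_or_imp,
    exists_eq_left, map_pow, map_mul, lift_x]

theorem exists_mem_order9 (a : ℕ → G) :
    (∃ f ∈ order9, FreeGroup.lift a f = 1) ↔
      a 1 ^ 20 = 1 ∨ a 2 ^ 20 = 1 ∨ a 1 ^ 2 = a 2 ^ 2 ∨ (a 1 ^ 2 * a 2 ^ 2) ^ 10 = 1 ∨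
      (a 1 ^ 4 * a 2 ^ 2) ^ 2 = 1 := by
  simp only [order9, Finset.mem_insert, Finset.mem_singleton, exists_eq_or_imp,
    exists_eq_left, map_pow, map_mul, lift_x, lift_eqn]

theorem exists_mem_abelian12 (a : ℕ → G) :
    (∃ f ∈ abelian12, FreeGroup.lift a f = 1) ↔
      a 1 ^ 15 = 1 ∨ a 2 ^ 15 = 1 ∨ a 1 ^ 4 = 1 ∨ a 2 ^ 4 = 1 ∨ (a 1 * a 2) ^ 15 = 1 ∨
      (a 1 * a 2) ^ 4 = 1 := by
  simp only [abelian12, Finset.mem_insert, Finset.mem_singleton, exists_eq_or_imp,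
    exists_eq_left, map_pow, map_mul, lift_x]

theorem exists_mem_dicyclic12 (a : ℕ → G) :
    (∃ f ∈ dicyclic12, FreeGroup.lift a f = 1) ↔
      a 1 ^ 10 = 1 ∨ a 2 ^ 10 = 1 ∨ a 1 ^ 4 = a 2 ^ 4 ∨ a 1 ^ 6 = a 2 ^ 6 ∨
      (a 1 ^ 2 * a 2 ^ 2) ^ 3 = 1 ∨ (a 1 ^ 2 * a 2 ^ 2) ^ 4 = 1 ∨ (a 1 ^ 2 * a 2 ^ 2) ^ 5 = 1 := by
  simp only [dicyclic12, Finset.mem_insert, Finset.mem_singleton, exists_eq_or_imp,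
    exists_eq_left, map_pow, map_mul, lift_x, lift_eqn]

theorem exists_mem_order25 (a : ℕ → G) :
    (∃ f ∈ order25, FreeGroup.lift a f = 1) ↔
      a 1 ^ 12 = 1 ∨ a 2 ^ 12 = 1 ∨ (a 1 * a 2) ^ 12 = 1 ∨ (a 1 * a 2 ^ 2) ^ 12 = 1 ∨
      (a 1 * a 2 ^ 3) ^ 12 = 1 ∨ (a 1 * a 2 ^ 4) ^ 12 = 1 := by
  simp only [order25, Finset.mem_insert, Finset.mem_singleton, exists_eq_or_imp,
    exists_eq_left, map_pow, map_mul, lift_x]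

/-- The relation between group elements that the formula `memCyc` expresses. -/
def MemCyc (g h : G) : Prop := g = 1 ∨ g = h ∨ g = h ^ 2 ∨ g = h ^ 3

theorem exists_mem_memCyc (a : ℕ → G) (f g : Word) :
    (∃ w ∈ memCyc f g, FreeGroup.lift a w = 1) ↔
      MemCyc (FreeGroup.lift a f) (FreeGroup.lift a g) := by
  simp only [memCyc, MemCyc, Finset.mem_insert, Finset.mem_singleton, exists_eq_or_imp,
    exists_eq_left, lift_eqn, map_pow]

theorem exists_mem_elementaryAbelian8 (a : ℕ → G) {y : Fin 3 → G}
    (hy : ∀ i, y i = a (i + 1) ^ 15) :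
    (∃ f ∈ elementaryAbelian8, FreeGroup.lift a f = 1) ↔
      (∃ i j, i ≠ j ∧ MemCyc (y i) (y j)) ∨
      (∃ σ : Perm (Fin 3), MemCyc (y (σ 0)) (y (σ 1) * y (σ 2))) ∨
      (∃ σ : Perm (Fin 3), MemCyc (y (σ 0) * y (σ 1)) (y (σ 1) * y (σ 2))) ∨
      (∃ i, y i = 1) ∨ (∃ i j, i ≠ j ∧ (y i * y j) ^ 15 = 1) ∨
      (∃ i j k, (j ≠ i ∧ i ≠ k) ∧ (y i * y j * y k) ^ 15 = 1) ∨
      (∃ i j k, (j ≠ i ∧ i ≠ k) ∧ (y i * y j * y k * y j) ^ 15 = 1) := by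
  obtain rfl : y = fun i : Fin 3 => a (i + 1) ^ 15 := funext hy
  simp only [elementaryAbelian8, theta, Finset.mem_union, Finset.mem_biUnion, Finset.mem_filter,
    Finset.mem_univ, true_and, Finset.mem_image, Prod.exists, or_and_right, exists_or, or_assoc]
  simp only [← exists_and_right, exists_comm (α := Word), and_assoc, exists_eq_left',
    exists_and_left, exists_mem_memCyc, map_mul, map_pow, lift_x]

end Substitution

/-! ### Permutations of five points as natural numbers -/

/-- The permutation `σ` of `Fin 5` is encoded by the number whose octal digits are its values:
the kernel computes with numbers much faster than with permutations. -/
def code (σ : Perm (Fin 5)) : ℕ :=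
  σ 0 + 8 * (σ 1 + 8 * (σ 2 + 8 * (σ 3 + 8 * σ 4)))

/-- The `i`-th octal digit of `p`. -/
def digit (p i : ℕ) : ℕ := p / 8 ^ i % 8

/-- Composition of encoded permutations. -/
def codeMul (p q : ℕ) : ℕ :=
  digit p (digit q 0) + 8 * (digit p (digit q 1) + 8 * (digit p (digit q 2) +
    8 * (digit p (digit q 3) + 8 * digit p (digit q 4))))

/-- The code of the identity. -/
def codeOne : ℕ := Nat.ofDigits 8 (List.range 5)

/-- Powers of encoded permutations. -/
def codePow (p : ℕ) : ℕ → ℕ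
  | 0 => codeOne
  | n + 1 => codeMul (codePow p n) p

/-- The codes of all permutations of `Fin 5`. -/
def codes : List ℕ := (List.range 5).permutations'.map (Nat.ofDigits 8)

/-- Codes of representatives of the conjugacy classes of permutations of `Fin 5`. -/
def classCodes : List ℕ :=
  [[0, 1, 2, 3, 4], [1, 0, 2, 3, 4], [1, 0, 3, 2, 4], [1, 2, 0, 3, 4], [1, 2, 0, 4, 3],
    [1, 2, 3, 0, 4], [1, 2, 3, 4, 0]].map (Nat.ofDigits 8)

theorem digit_code (σ : Perm (Fin 5)) (i : Fin 5) : digit (code σ) i = σ i := by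
  have (j : Fin 5) : (σ j : ℕ) < 5 := (σ j).isLt
  simp only [Fin.forall_fin_succ] at this
  fin_cases i <;> simp [digit, code] <;> omega

theorem code_injective : Function.Injective code := fun σ τ h => by
  ext i
  rw [← digit_code, ← digit_code, h]

theorem code_mul (σ τ : Perm (Fin 5)) : code (σ * τ) = codeMul (code σ) (code τ) := by
  have h (i : Fin 5) : digit (code σ) (digit (code τ) i) = σ (τ i) := by
    rw [digit_code, digit_code]
  simp only [Fin.forall_fin_succ, Fin.succ_zero_eq_one] at h
  exact (congrArg₂ _ h.1 <| congrArg _ <| congrArg₂ _ h.2.1 <| congrArg _ <|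
    congrArg₂ _ h.2.2.1 <| congrArg _ <| congrArg₂ _ h.2.2.2.1 <| congrArg _ h.2.2.2.2.1).symm

theorem code_one : code 1 = codeOne := rfl

theorem code_pow (σ : Perm (Fin 5)) (n : ℕ) : code (σ ^ n) = codePow (code σ) n := by
  induction n with
  | zero => exact code_one
  | succ n ih => rw [pow_succ, code_mul, ih, codePow]

theorem code_mem_codes (σ : Perm (Fin 5)) : code σ ∈ codes :=
  List.mem_map_of_mem <| List.mem_permutations'.2 <|
    Equiv.Perm.ofFn_comp_perm σ (fun i : Fin 5 => (i : ℕ))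

theorem exists_code_eq {p : ℕ} (hp : p ∈ codes) : ∃ σ, code σ = p := by
  have h : Finset.univ.image code = codes.toFinset := by
    refine Finset.eq_of_subset_of_card_le (fun p hp => ?_) ?_
    · obtain ⟨σ, -, rfl⟩ := Finset.mem_image.1 hp
      exact List.mem_toFinset.2 (code_mem_codes σ)
    · rw [Finset.card_image_of_injective _ code_injective, Finset.card_univ, Fintype.card_perm]
      exact (List.toFinset_card_le _).trans (by decide +kernel)
  rw [← List.mem_toFinset, ← h] at hp
  simpa using hp

theorem exists_conj_mem_classCodes (σ : Perm (Fin 5)) :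
    ∃ g : Perm (Fin 5), code (g * σ * g⁻¹) ∈ classCodes := by
  have h : ∀ p ∈ codes, ∃ g ∈ codes, ∃ r ∈ classCodes, r ∈ codes ∧ codeMul g p = codeMul r g := by
    decide +kernel
  obtain ⟨g, hg, r, hr, hr', e⟩ := h _ (code_mem_codes σ)
  obtain ⟨g, rfl⟩ := exists_code_eq hg
  obtain ⟨r, rfl⟩ := exists_code_eq hr'
  rw [← code_mul, ← code_mul] at e
  exact ⟨g, by rwa [code_injective e, mul_inv_cancel_right]⟩

theorem satisfies_of_classCodes (w : Word) {δ : DFormula}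
    (h : ∀ a : ℕ → Perm (Fin 5), code (FreeGroup.lift a w) ∈ classCodes →
      ∃ f ∈ δ, FreeGroup.lift a f = 1) : Satisfies (Perm (Fin 5)) δ := by
  intro a
  obtain ⟨g, hg⟩ := exists_conj_mem_classCodes (FreeGroup.lift a w)
  have lift_conj (f : Word) :
      FreeGroup.lift (fun i => g * a i * g⁻¹) f = g * FreeGroup.lift a f * g⁻¹ :=
    DFunLike.congr_fun (FreeGroup.ext_hom _ _ fun i => by simp :
      _ = (MulAut.conj g).toMonoidHom.comp (FreeGroup.lift a)) f
  obtain ⟨f, hf, e⟩ := h (fun i => g * a i * g⁻¹) (by rwa [lift_conj])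
  exact ⟨f, hf, conj_eq_one_iff.1 (lift_conj f ▸ e)⟩

/-! ### The formulas in `S₅` -/

theorem satisfies_exponents456 : Satisfies (Perm (Fin 5)) exponents456 := by
  have key : ∀ p ∈ classCodes,
      codePow p 4 = codeOne ∨ codePow p 5 = codeOne ∨ codePow p 6 = codeOne := by
    decide +kernel
  refine satisfies_of_classCodes (x 1) fun a ha => ?_
  rw [exists_mem_exponents456]
  simpa only [lift_x, ← code_injective.eq_iff, code_pow, code_one] using key _ ha

theorem satisfies_fourCycles : Satisfies (Perm (Fin 5)) fourCycles := by
  have key : ∀ p ∈ classCodes, codePow p 30 = codeOne ∨ ∀ q ∈ codes,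
      codePow q 30 = codeOne ∨ codePow (codeMul p q) 15 = codeOne ∨
      codePow (codeMul p (codePow q 2)) 15 = codeOne ∨
      codePow (codeMul p (codePow q 3)) 15 = codeOne := by
    decide +kernel
  refine satisfies_of_classCodes (x 1) fun a ha => ?_
  rw [exists_mem_fourCycles]
  simpa only [lift_x, ← code_injective.eq_iff, code_pow, code_one, code_mul] using
    (key _ ha).imp_right fun h => h _ (code_mem_codes (a 2))

theorem satisfies_order9 : Satisfies (Perm (Fin 5)) order9 := by
  have key : ∀ p ∈ classCodes, codePow p 20 = codeOne ∨ ∀ q ∈ codes,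
      codePow q 20 = codeOne ∨ codePow p 2 = codePow q 2 ∨
      codePow (codeMul (codePow p 2) (codePow q 2)) 10 = codeOne ∨
      codePow (codeMul (codePow p 4) (codePow q 2)) 2 = codeOne := by
    decide +kernel
  refine satisfies_of_classCodes (x 1) fun a ha => ?_
  rw [exists_mem_order9]
  simpa only [lift_x, ← code_injective.eq_iff, code_pow, code_one, code_mul] using
    (key _ ha).imp_right fun h => h _ (code_mem_codes (a 2))

theorem satisfies_abelian12 : Satisfies (Perm (Fin 5)) abelian12 := by
  have key : ∀ p ∈ classCodes, codePow p 15 = codeOne ∨ ∀ q ∈ codes,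
      codePow q 15 = codeOne ∨ codePow p 4 = codeOne ∨
      codePow q 4 = codeOne ∨ codePow (codeMul p q) 15 = codeOne ∨
      codePow (codeMul p q) 4 = codeOne := by
    decide +kernel
  refine satisfies_of_classCodes (x 1) fun a ha => ?_
  rw [exists_mem_abelian12]
  simpa only [lift_x, ← code_injective.eq_iff, code_pow, code_one, code_mul] using
    (key _ ha).imp_right fun h => h _ (code_mem_codes (a 2))

theorem satisfies_dicyclic12 : Satisfies (Perm (Fin 5)) dicyclic12 := by
  have key : ∀ p ∈ classCodes, codePow p 10 = codeOne ∨ ∀ q ∈ codes,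
      codePow q 10 = codeOne ∨ codePow p 4 = codePow q 4 ∨
      codePow p 6 = codePow q 6 ∨
      codePow (codeMul (codePow p 2) (codePow q 2)) 3 = codeOne ∨
      codePow (codeMul (codePow p 2) (codePow q 2)) 4 = codeOne ∨
      codePow (codeMul (codePow p 2) (codePow q 2)) 5 = codeOne := by
    decide +kernel
  refine satisfies_of_classCodes (x 1) fun a ha => ?_
  rw [exists_mem_dicyclic12]
  simpa only [lift_x, ← code_injective.eq_iff, code_pow, code_one, code_mul] using
    (key _ ha).imp_right fun h => h _ (code_mem_codes (a 2))

theorem satisfies_order25 : Satisfies (Perm (Fin 5)) order25 := by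
  have key : ∀ p ∈ classCodes, codePow p 12 = codeOne ∨ ∀ q ∈ codes,
      codePow q 12 = codeOne ∨ codePow (codeMul p q) 12 = codeOne ∨
      codePow (codeMul p (codePow q 2)) 12 = codeOne ∨
      codePow (codeMul p (codePow q 3)) 12 = codeOne ∨
      codePow (codeMul p (codePow q 4)) 12 = codeOne := by
    decide +kernel
  refine satisfies_of_classCodes (x 1) fun a ha => ?_
  rw [exists_mem_order25]
  simpa only [lift_x, ← code_injective.eq_iff, code_pow, code_one, code_mul] using
    (key _ ha).imp_right fun h => h _ (code_mem_codes (a 2))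

/-- The codes of the permutations of `Fin 5` whose order is a power of two. -/
def twoCodes : List ℕ := codes.filter (codePow · 4 = codeOne)

theorem code_pow_fifteen_mem_twoCodes (σ : Perm (Fin 5)) : code (σ ^ 15) ∈ twoCodes := by
  have h : (σ ^ 15) ^ 4 = 1 := by
    rw [← pow_mul, ← orderOf_dvd_iff_pow_eq_one]
    rcases (exists_mem_exponents456 fun _ => σ).1 (satisfies_exponents456 _) with h | h | h <;>
      exact (orderOf_dvd_of_pow_eq_one h).trans (by decide)
  refine List.mem_filter.2 ⟨code_mem_codes _, decide_eq_true ?_⟩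
  rw [← code_pow, h, code_one]

-- These eleven equations among those of `elementaryAbelian8` already cover all the triples that
-- violate the shorter ones.
theorem twoCodes_relation : ∀ p ∈ classCodes, p ∈ twoCodes → p ≠ codeOne →
    ∀ q ∈ twoCodes, codePow (codeMul p q) 15 ≠ codeOne → p ≠ codePow q 2 → q ≠ codePow p 2 →
    ∀ r ∈ twoCodes, codePow (codeMul p r) 15 ≠ codeOne → p ≠ codePow r 2 → r ≠ codePow p 2 →
      codePow (codeMul q r) 15 ≠ codeOne → q ≠ codePow r 2 → r ≠ codePow q 2 →
    p = codePow (codeMul r q) 2 ∨ q = codePow (codeMul r p) 2 ∨ r = codePow (codeMul q p) 2 ∨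
      codeMul q r = codePow (codeMul r p) 3 ∨ codeMul r p = codePow (codeMul p q) 3 ∨
      codeMul r q = codePow (codeMul q p) 3 ∨
      codePow (codeMul (codeMul r p) q) 15 = codeOne ∨
      codePow (codeMul (codeMul r q) p) 15 = codeOne ∨
      codePow (codeMul (codeMul (codeMul q r) p) r) 15 = codeOne ∨
      codePow (codeMul (codeMul (codeMul r p) q) p) 15 = codeOne ∨
      codePow (codeMul (codeMul (codeMul r q) p) q) 15 = codeOne := by
  decide +kernel

theorem satisfies_elementaryAbelian8 : Satisfies (Perm (Fin 5)) elementaryAbelian8 := by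
  refine satisfies_of_classCodes (x 1 ^ 15) fun a ha => ?_
  obtain ⟨y, hy⟩ : ∃ y : Fin 3 → Perm (Fin 5), ∀ i, y i = a (i + 1) ^ 15 := ⟨_, fun _ => rfl⟩
  have two_mem (i : Fin 3) : code (y i) ∈ twoCodes := hy i ▸ code_pow_fifteen_mem_twoCodes _
  have class_mem : code (y 0) ∈ classCodes := by simpa [hy, lift_x] using ha
  rw [exists_mem_elementaryAbelian8 a hy]
  by_contra! h
  simp only [MemCyc, not_or] at h
  obtain ⟨cyc, cyc_mul, mul_cyc, one, two, three, four⟩ := h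
  have exists_perm {i j k : Fin 3} : i ≠ j → i ≠ k → j ≠ k →
      ∃ σ : Perm (Fin 3), σ 0 = i ∧ σ 1 = j ∧ σ 2 = k := by revert i j k; decide
  have sq_mul {i j k : Fin 3} (hij : i ≠ j) (hik : i ≠ k) (hjk : j ≠ k) :
      y i ≠ (y j * y k) ^ 2 := by
    obtain ⟨σ, rfl, rfl, rfl⟩ := exists_perm hij hik hjk
    exact (cyc_mul σ).2.2.1
  have mul_cube {i j k : Fin 3} (hij : i ≠ j) (hik : i ≠ k) (hjk : j ≠ k) :
      y i * y j ≠ (y j * y k) ^ 3 := by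
    obtain ⟨σ, rfl, rfl, rfl⟩ := exists_perm hij hik hjk
    exact (mul_cyc σ).2.2.2
  have key := twoCodes_relation (code (y 0)) class_mem (two_mem 0)
  simp only [← code_one, ← code_pow, code_injective.ne_iff] at key
  have key := key (one 0) (code (y 1)) (two_mem 1)
  simp only [← code_mul, ← code_pow, code_injective.ne_iff] at key
  have key := key (two 0 1 (by decide)) (cyc 0 1 (by decide)).2.2.1 (cyc 1 0 (by decide)).2.2.1
    (code (y 2)) (two_mem 2)
  simp only [← code_mul, ← code_pow, code_injective.ne_iff, code_injective.eq_iff] at key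
  rcases key (two 0 2 (by decide)) (cyc 0 2 (by decide)).2.2.1 (cyc 2 0 (by decide)).2.2.1
    (two 1 2 (by decide)) (cyc 1 2 (by decide)).2.2.1 (cyc 2 1 (by decide)).2.2.1 with
    h | h | h | h | h | h | h | h | h | h | h
  iterate 3 exact sq_mul (by decide) (by decide) (by decide) h
  iterate 3 exact mul_cube (by decide) (by decide) (by decide) h
  iterate 2 exact three _ _ _ (by decide) h
  iterate 3 exact four _ _ _ (by decide) h

/-! ### Subgroups of prime power order -/

section PrimePower

variable {G : Type*} [Group G]

theorem pow_sixty_eq_one (h : Satisfies G exponents456) (a : G) : a ^ 60 = 1 := by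
  rw [← orderOf_dvd_iff_pow_eq_one]
  rcases (exists_mem_exponents456 fun _ => a).1 (h _) with h | h | h <;>
    exact (orderOf_dvd_of_pow_eq_one h).trans (by decide)

theorem eq_one_of_pow_eq_one_of_coprime {a : G} {m n : ℕ} (hmn : m.Coprime n) (hm : a ^ m = 1)
    (hn : a ^ n = 1) : a = 1 := by
  rw [← pow_one a, ← hmn.gcd_eq_one, pow_gcd_eq_one]
  exact ⟨hm, hn⟩

theorem pow_eq_one_of_isPGroup {p : ℕ} (hG : IsPGroup p G) {m n : ℕ}
    (hmn : m.Coprime p) {a : G} (ha : a ^ (m * n) = 1) : a ^ n = 1 := by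
  obtain ⟨k, hk⟩ := hG a
  refine eq_one_of_pow_eq_one_of_coprime (hmn.pow_right k) ?_ ?_
  · rw [← pow_mul, mul_comm, ha]
  · rw [pow_right_comm, hk, one_pow]

theorem mem_zpowers_of_mul_pow_eq_one {a b : G} {n : ℕ} (h : a * b ^ n = 1) :
    a ∈ Subgroup.zpowers b := by
  rw [eq_inv_of_mul_eq_one_left h]
  exact inv_mem (Subgroup.npow_mem_zpowers b n)

theorem card_dvd_prime_of_forall_mem_zpowers {p : ℕ} (h : ∀ a : G, a ^ p = 1)
    (hcyc : ∀ a b : G, b ≠ 1 → a ∈ Subgroup.zpowers b) : Nat.card G ∣ p := by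
  by_cases htriv : ∃ b : G, b ≠ 1
  · obtain ⟨b, hb⟩ := htriv
    rw [← orderOf_eq_card_of_forall_mem_zpowers fun a => hcyc a b hb]
    exact orderOf_dvd_of_pow_eq_one (h b)
  · push Not at htriv
    have : Subsingleton G := ⟨fun a b => by rw [htriv a, htriv b]⟩
    rw [Nat.card_unique]
    exact one_dvd p

theorem mem_zpowers_of_pow_five (h : Satisfies G order25) {a b : G} (hb : b ^ 5 = 1)
    (hb' : b ≠ 1) (hab : ∀ n : ℕ, (a * b ^ n) ^ 5 = 1) : a ∈ Subgroup.zpowers b := by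
  have key {c : G} (hc : c ^ 5 = 1) (hc' : c ^ 12 = 1) : c = 1 :=
    eq_one_of_pow_eq_one_of_coprime (by decide) hc hc'
  rcases (exists_mem_order25 _).1 (h fun n => if n = 1 then a else b) with h | h | h | h | h | h
  · exact mem_zpowers_of_mul_pow_eq_one (key (hab 0) (by simpa using h))
  · exact absurd (key hb h) hb'
  · exact mem_zpowers_of_mul_pow_eq_one (key (hab 1) (by simpa using h))
  · exact mem_zpowers_of_mul_pow_eq_one (key (hab 2) h)
  · exact mem_zpowers_of_mul_pow_eq_one (key (hab 3) h)
  · exact mem_zpowers_of_mul_pow_eq_one (key (hab 4) h)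

theorem card_dvd_five (h : Satisfies G order25) (h5 : ∀ a : G, a ^ 5 = 1) : Nat.card G ∣ 5 :=
  card_dvd_prime_of_forall_mem_zpowers h5 fun _ b hb =>
    mem_zpowers_of_pow_five h (h5 b) hb fun _ => h5 _

theorem card_dvd_three (h : Satisfies G order9) (h3 : ∀ a : G, a ^ 3 = 1) : Nat.card G ∣ 3 := by
  refine card_dvd_prime_of_forall_mem_zpowers h3 fun a b hb => ?_
  have key {c : G} {m : ℕ} (hm : Nat.Coprime 3 m) (hc : c ^ m = 1) : c = 1 :=
    eq_one_of_pow_eq_one_of_coprime hm (h3 c) hc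
  have hsq (c : G) : c ^ 2 = c⁻¹ := eq_inv_of_mul_eq_one_left (by rw [← pow_succ, h3])
  rcases (exists_mem_order9 _).1 (h fun n => if n = 1 then a else b) with h | h | h | h | h
  · rw [show a = 1 from key (by decide) h]
    exact one_mem _
  · exact absurd (key (by decide) h) hb
  · have h : a ^ 2 = b ^ 2 := h
    rw [hsq, hsq, inv_inj] at h
    exact h ▸ Subgroup.mem_zpowers a
  · have h : a ^ 2 * b ^ 2 = 1 := key (by decide) h
    rw [hsq, inv_mul_eq_one] at h
    exact h ▸ Subgroup.npow_mem_zpowers b 2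
  · have h : a ^ 4 * b ^ 2 = 1 := key (by decide) h
    rw [pow_eq_pow_mod 4 (h3 a), pow_one] at h
    exact mem_zpowers_of_mul_pow_eq_one h

theorem mem_zpowers_of_pow_four (h : Satisfies G fourCycles) {a b : G} (ha : a ^ 2 ≠ 1)
    (hb : b ^ 4 = 1) (hb' : b ^ 2 ≠ 1) (hab : ∀ n : ℕ, (a * b ^ n) ^ 4 = 1) :
    a ∈ Subgroup.zpowers b := by
  have key {c : G} (hc : c ^ 4 = 1) (hc' : c ^ 15 = 1) : c = 1 :=
    eq_one_of_pow_eq_one_of_coprime (by decide) hc hc'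
  rcases (exists_mem_fourCycles _).1 (h fun n => if n = 1 then a else b) with h | h | h | h | h
  · have ha4 : a ^ 4 = 1 := by simpa using hab 0
    exact absurd (pow_eq_pow_mod 30 ha4 ▸ h) ha
  · exact absurd (pow_eq_pow_mod 30 hb ▸ h) hb'
  · exact mem_zpowers_of_mul_pow_eq_one (key (hab 1) (by simpa using h))
  · exact mem_zpowers_of_mul_pow_eq_one (key (hab 2) h)
  · exact mem_zpowers_of_mul_pow_eq_one (key (hab 3) h)

theorem conj_eq_inv_of_forall_sq_eq_one {b c : G} (h : ∀ a ∉ Subgroup.zpowers c, a ^ 2 = 1)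
    (hb : b ∉ Subgroup.zpowers c) : b * c * b⁻¹ = c⁻¹ := by
  have hbc : (b * c) ^ 2 = 1 :=
    h _ fun hbc => hb ((Subgroup.mul_mem_cancel_right _ (Subgroup.mem_zpowers c)).1 hbc)
  have hinv : b⁻¹ = b := inv_eq_of_mul_eq_one_left (by rw [← sq, h b hb])
  rw [hinv, eq_inv_iff_mul_eq_one, ← hbc, sq, mul_assoc]

theorem index_zpowers_dvd_two {c : G} (hc : c ^ 2 ≠ 1)
    (h : ∀ a ∉ Subgroup.zpowers c, a ^ 2 = 1) : (Subgroup.zpowers c).index ∣ 2 := by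
  by_cases htop : ∀ b, b ∈ Subgroup.zpowers c
  · rw [(Subgroup.eq_top_iff' _).2 htop, Subgroup.index_top]
    exact one_dvd 2
  push Not at htop
  obtain ⟨b, hb⟩ := htop
  refine (Subgroup.index_eq_two_iff.2 ⟨b, fun a => ?_⟩).dvd
  by_cases ha : a ∈ Subgroup.zpowers c
  · exact .inr ⟨ha, fun hab => hb ((Subgroup.mul_mem_cancel_left _ ha).1 hab)⟩
  refine .inl ⟨?_, ha⟩
  by_contra hab
  have conj_mul : a * b * c * (a * b)⁻¹ = (a * c * a⁻¹)⁻¹ := by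
    rw [conj_inv, ← conj_eq_inv_of_forall_sq_eq_one h hb]
    group
  rw [conj_eq_inv_of_forall_sq_eq_one h hab, conj_eq_inv_of_forall_sq_eq_one h ha, inv_inj,
    eq_inv_iff_mul_eq_one, ← sq] at conj_mul
  exact hc conj_mul

theorem card_dvd_eight_of_sq_ne_one (h : Satisfies G fourCycles) (h4 : ∀ a : G, a ^ 4 = 1) {c : G}
    (hc : c ^ 2 ≠ 1) : Nat.card G ∣ 8 := by
  have hidx : (Subgroup.zpowers c).index ∣ 2 := index_zpowers_dvd_two hc fun a ha =>
    of_not_not fun ha' => ha (mem_zpowers_of_pow_four h ha' (h4 c) hc fun _ => h4 _)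
  rw [← Subgroup.card_mul_index (Subgroup.zpowers c), Nat.card_zpowers]
  exact mul_dvd_mul (orderOf_dvd_of_pow_eq_one (h4 c)) hidx

theorem exists_relation_of_sq_eq_one (h : Satisfies G elementaryAbelian8) (hsq : ∀ a : G, a ^ 2 = 1)
    (y : Fin 3 → G) : (∃ i, y i = 1) ∨ (∃ i j, i ≠ j ∧ y i = y j) ∨
      ∃ i j k, i ≠ j ∧ i ≠ k ∧ j ≠ k ∧ y i = y j * y k := by
  have hpow (a : G) : a ^ 15 = a := by rw [pow_eq_pow_mod 15 (hsq a), pow_one]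
  have hinv (a : G) : a⁻¹ = a := inv_eq_of_mul_eq_one_left (by rw [← sq, hsq])
  have hcomm (a b : G) : a * b = b * a :=
    Commute.of_orderOf_dvd_two (fun c => orderOf_dvd_of_pow_eq_one (hsq c)) a b
  have hmul (a b : G) : a * b = 1 ↔ a = b := by rw [mul_eq_one_iff_eq_inv, hinv]
  have hcyc (a b : G) : MemCyc a b ↔ a = 1 ∨ a = b := by
    rw [MemCyc, hsq, pow_eq_pow_mod 3 (hsq b), pow_one]
    tauto
  have := (exists_mem_elementaryAbelian8 (fun n => y (Fin.ofNat 3 (n - 1))) (y := y) fun i => by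
    simp [hpow]).1 (h _)
  simp only [hcyc, hpow, hmul] at this
  by_contra! hne
  obtain ⟨h1, h2, h3⟩ := hne
  rcases this with ⟨i, j, hij, h⟩ | ⟨σ, h⟩ | ⟨σ, h | h⟩ | ⟨i, h⟩ | ⟨i, j, hij, h⟩ |
    ⟨i, j, k, ⟨hji, hik⟩, h⟩ | ⟨i, j, k, ⟨-, hik⟩, h⟩
  · exact h.elim (h1 i) (h2 i j hij)
  · exact h.elim (h1 _) (h3 _ _ _ (by simp) (by simp) (by simp))
  · exact h2 _ _ (by simp) h
  · rw [hcomm, mul_right_inj] at h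
    exact h2 _ _ (by simp) h
  · exact h1 i h
  · exact h2 i j hij h
  · by_cases hjk : j = k
    · exact h1 i (by rwa [hjk, mul_eq_right] at h)
    · exact h3 k i j hik.symm (Ne.symm hjk) hji.symm h.symm
  · rw [hcomm (y i), mul_assoc, mul_eq_left, hmul] at h
    exact h2 i k hik h

theorem card_le_four_of_sq_eq_one (h : Satisfies G elementaryAbelian8)
    (hsq : ∀ a : G, a ^ 2 = 1) : Nat.card G ≤ 4 := by
  classical
  have hcomm (a b : G) : a * b = b * a :=
    Commute.of_orderOf_dvd_two (fun c => orderOf_dvd_of_pow_eq_one (hsq c)) a b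
  obtain ⟨a, b, hab⟩ : ∃ a b : G, ∀ c, c ∈ ({1, a, b, a * b} : Finset G) := by
    by_contra! hne
    obtain ⟨a, ha⟩ := hne 1 1
    obtain ⟨b, hb⟩ := hne a a
    obtain ⟨c, hc⟩ := hne a b
    simp only [Finset.mem_insert, Finset.mem_singleton, not_or] at ha hb hc
    obtain ⟨hc, hca, hcb, hcab⟩ := hc
    have hbac : b ≠ a * c := fun e => hcab (by rw [e, ← mul_assoc, ← sq, hsq, one_mul])
    have habc : a ≠ b * c := fun e => hcab (by rw [e, hcomm b, mul_assoc, ← sq, hsq, mul_one])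
    have := exists_relation_of_sq_eq_one h hsq ![a, b, c]
    simp [Fin.exists_fin_succ, ha.1, hb.1, hc, hb.2.1, Ne.symm hb.2.1, hca, Ne.symm hca, hcb,
      Ne.symm hcb, hcab, habc, hbac, hcomm b a, hcomm c] at this
  refine (Nat.card_le_card_of_injective (fun c => (⟨c, hab c⟩ : ({1, a, b, a * b} : Finset G)))
    fun c d hcd => congrArg Subtype.val hcd).trans ?_
  rw [Nat.card_eq_fintype_card, Fintype.card_coe]
  exact Finset.card_le_four

theorem card_dvd_eight [Finite G] (h3 : Satisfies G fourCycles)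
    (h4 : Satisfies G elementaryAbelian8) (h : ∀ a : G, a ^ 4 = 1) : Nat.card G ∣ 8 := by
  by_cases hsq : ∀ a : G, a ^ 2 = 1
  · have hle := card_le_four_of_sq_eq_one h4 hsq
    have h2 : IsPGroup 2 G := fun a => ⟨1, by rw [pow_one, hsq]⟩
    obtain ⟨k, hk⟩ := IsPGroup.iff_card.1 h2
    rw [hk] at hle ⊢
    refine pow_dvd_pow 2 (n := 3) ?_
    by_contra! hk
    have := Nat.pow_le_pow_right (n := 2) (by norm_num) hk.le
    omega
  · push Not at hsq
    obtain ⟨c, hc⟩ := hsq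
    exact card_dvd_eight_of_sq_ne_one h3 h hc

end PrimePower

/-! ### Finite models -/

/-- The groups that satisfy the formulas 2–8. Formula 1 bounds the order, and enters the
classification only through `Finite`. -/
structure IsModel (G : Type*) [Group G] : Prop where
  exponents456 : Satisfies G exponents456
  fourCycles : Satisfies G fourCycles
  elementaryAbelian8 : Satisfies G elementaryAbelian8
  order9 : Satisfies G order9
  abelian12 : Satisfies G abelian12
  dicyclic12 : Satisfies G dicyclic12
  order25 : Satisfies G order25

namespace IsModel

variable {G : Type*} [Group G]

theorem subgroup (h : IsModel G) (K : Subgroup G) : IsModel K where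
  exponents456 := h.exponents456.of_injective K.subtype_injective
  fourCycles := h.fourCycles.of_injective K.subtype_injective
  elementaryAbelian8 := h.elementaryAbelian8.of_injective K.subtype_injective
  order9 := h.order9.of_injective K.subtype_injective
  abelian12 := h.abelian12.of_injective K.subtype_injective
  dicyclic12 := h.dicyclic12.of_injective K.subtype_injective
  order25 := h.order25.of_injective K.subtype_injective

theorem card_dvd_of_isPGroup [Finite G] (h : IsModel G) {p : ℕ} (hp : p.Prime)
    (hG : IsPGroup p G) : Nat.card G ∣ 120 := by
  have hpow {m n : ℕ} (hmn : m * n = 60) (hm : m.Coprime p) (a : G) : a ^ n = 1 :=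
    pow_eq_one_of_isPGroup hG hm (hmn ▸ pow_sixty_eq_one h.exponents456 a)
  by_cases h2 : p = 2
  · subst h2
    exact (card_dvd_eight h.fourCycles h.elementaryAbelian8
      (hpow (m := 15) rfl (by decide))).trans (by decide)
  by_cases h3 : p = 3
  · subst h3
    exact (card_dvd_three h.order9 (hpow (m := 20) rfl (by decide))).trans (by decide)
  by_cases h5 : p = 5
  · subst h5
    exact (card_dvd_five h.order25 (hpow (m := 12) rfl (by decide))).trans (by decide)
  have hcop : Nat.Coprime (2 * 2 * 3 * 5) p := by
    simp only [Nat.coprime_mul_iff_left, Nat.coprime_primes Nat.prime_two hp,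
      Nat.coprime_primes Nat.prime_three hp, Nat.coprime_primes Nat.prime_five hp]
    tauto
  have : Subsingleton G := ⟨fun a b => by
    rw [← pow_one a, ← pow_one b, hpow rfl hcop a, hpow rfl hcop b]⟩
  rw [Nat.card_unique]
  exact one_dvd _

theorem card_dvd [Finite G] (h : IsModel G) : Nat.card G ∣ 120 := by
  rw [Nat.dvd_iff_prime_pow_dvd_dvd]
  intro p k hp hpk
  have : Fact p.Prime := ⟨hp⟩
  obtain ⟨K, hK⟩ := Sylow.exists_subgroup_card_pow_prime p hpk
  exact hK ▸ (h.subgroup K).card_dvd_of_isPGroup hp (IsPGroup.of_card hK)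

end IsModel

/-! ### Embeddings into symmetric groups -/

/-- `G` is isomorphic to a subgroup of the symmetric group of degree `n`. -/
def EmbedsInPerm (n : ℕ) (G : Type*) [Group G] : Prop :=
  ∃ f : G →* Perm (Fin n), Function.Injective f

section Embeddings

variable {G H : Type*} [Group G] [Group H] {n : ℕ}

theorem EmbedsInPerm.of_injective (h : EmbedsInPerm n H) (f : G →* H)
    (hf : Function.Injective f) : EmbedsInPerm n G :=
  let ⟨g, hg⟩ := h
  ⟨g.comp f, hg.comp hf⟩

theorem embedsInPerm_of_faithfulSMul (X : Type*) [Finite X] [MulAction G X] [FaithfulSMul G X]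
    (hX : Nat.card X ≤ n) : EmbedsInPerm n G := by
  have := Fintype.ofFinite X
  obtain ⟨ι⟩ : Nonempty (X ↪ Fin n) :=
    Function.Embedding.nonempty_of_card_le (by rwa [Fintype.card_fin, ← Nat.card_eq_fintype_card])
  exact ⟨(Perm.viaEmbeddingHom ι).comp (MulAction.toPermHom G X),
    (Perm.viaEmbeddingHom_injective ι).comp MulAction.toPerm_injective⟩

theorem embedsInPerm_of_card_le [Finite G] (h : Nat.card G ≤ n) : EmbedsInPerm n G :=
  embedsInPerm_of_faithfulSMul G h

theorem embedsInPerm_stabilizer {X : Type*} [Finite X] [MulAction G X] [FaithfulSMul G X] (x : X)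
    (hX : Nat.card X = n + 1) : EmbedsInPerm n (MulAction.stabilizer G x) := by
  have : FaithfulSMul (MulAction.stabilizer G x) (SubMulAction.ofStabilizer G x) := by
    refine ⟨fun {k l} hkl => Subtype.ext (FaithfulSMul.eq_of_smul_eq_smul fun y : X => ?_)⟩
    by_cases hy : y = x
    · rw [hy, k.2, l.2]
    · exact congrArg Subtype.val (hkl ⟨y, hy⟩)
  refine embedsInPerm_of_faithfulSMul (SubMulAction.ofStabilizer G x) ?_
  rw [SubMulAction.nat_card_ofStabilizer_eq, hX, Nat.add_sub_cancel]

theorem faithfulSMul_quotient {K : Subgroup G} (hK : K.normalCore = ⊥) :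
    FaithfulSMul G (G ⧸ K) := by
  have hinj : Function.Injective (MulAction.toPermHom G (G ⧸ K)) := by
    rw [← MonoidHom.ker_eq_bot_iff, ← Subgroup.normalCore_eq_ker, hK]
  exact ⟨fun h => hinj (Equiv.ext h)⟩

theorem embedsInPerm_of_index_le {K : Subgroup G} [K.FiniteIndex] (hK : K.normalCore = ⊥)
    (hidx : K.index ≤ n) : EmbedsInPerm n G :=
  have := faithfulSMul_quotient hK
  embedsInPerm_of_faithfulSMul (G ⧸ K) hidx

theorem embedsInPerm_of_index_add_index_le {K L : Subgroup G} [K.FiniteIndex] [L.FiniteIndex]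
    (hKL : Disjoint K.normalCore L.normalCore) (hidx : K.index + L.index ≤ n) :
    EmbedsInPerm n G := by
  have : FaithfulSMul G ((G ⧸ K) ⊕ (G ⧸ L)) := by
    have hinj : Function.Injective
        ((MulAction.toPermHom G (G ⧸ K)).prod (MulAction.toPermHom G (G ⧸ L))) := by
      rw [← MonoidHom.ker_eq_bot_iff, MonoidHom.ker_prod, ← Subgroup.normalCore_eq_ker,
        ← Subgroup.normalCore_eq_ker, hKL.eq_bot]
    exact ⟨fun h => hinj <| Prod.ext (Equiv.ext fun q => Sum.inl_injective (h (.inl q)))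
      (Equiv.ext fun q => Sum.inr_injective (h (.inr q)))⟩
  exact embedsInPerm_of_faithfulSMul ((G ⧸ K) ⊕ (G ⧸ L)) (Nat.card_sum.trans_le hidx)

theorem embedsInPerm_of_card_eq [Finite H] (f : G →* H) (hf : Function.Injective f)
    (hcard : Nat.card H = (n + 1) * Nat.card G) (hcore : f.range.normalCore = ⊥) :
    EmbedsInPerm n G := by
  have := Finite.of_injective f hf
  have := faithfulSMul_quotient hcore
  have hidx : f.range.index = n + 1 := by
    rw [Nat.card_congr (MonoidHom.ofInjective hf).toEquiv, ← f.range.index_mul_card] at hcard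
    exact Nat.eq_of_mul_eq_mul_right Nat.card_pos hcard
  have hstab := embedsInPerm_stabilizer (G := H) ((1 : H) : H ⧸ f.range) hidx
  rw [MulAction.stabilizer_quotient] at hstab
  exact hstab.of_injective f.rangeRestrict (f.rangeRestrict_injective_iff.2 hf)

end Embeddings

/-! ### Normal cores -/

section NormalCore

theorem normalCore_eq_bot_of_two_mul_card_lt {X : Type*} [Finite X] (hX : 5 ≤ Nat.card X)
    {K : Subgroup (Perm X)} (hK : 2 * Nat.card K < Nat.card (Perm X)) : K.normalCore = ⊥ := by
  classical
  have := Fintype.ofFinite X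
  have : Nontrivial X := Finite.one_lt_card_iff_nontrivial.1 (by omega)
  by_contra hne
  have hle : alternatingGroup X ≤ K :=
    (Perm.alternatingGroup_le_of_normal hX ((Subgroup.nontrivial_iff_ne_bot _).2 hne)).trans
      K.normalCore_le
  have hcard := Subgroup.card_le_of_le hle
  have := two_mul_nat_card_alternatingGroup (α := X)
  omega

variable {G : Type*} [Group G]

theorem normalCore_eq_bot_of_isSimpleGroup [IsSimpleGroup G] {K : Subgroup G} (hK : K ≠ ⊤) :
    K.normalCore = ⊥ :=
  K.normalCore_normal.eq_bot_or_eq_top.resolve_right fun h =>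
    hK (top_le_iff.1 (h ▸ K.normalCore_le))

theorem disjoint_or_le_of_card_prime {K L : Subgroup G} (hL : (Nat.card L).Prime) :
    Disjoint K L ∨ L ≤ K := by
  have : Fact (Nat.card L).Prime := ⟨hL⟩
  rw [← Subgroup.subgroupOf_eq_bot, ← Subgroup.subgroupOf_eq_top]
  exact Subgroup.eq_bot_or_eq_top_of_prime_card (K.subgroupOf L)

theorem normalCore_eq_bot_of_card_prime {K : Subgroup G} (hK : (Nat.card K).Prime)
    (hn : ¬K.Normal) : K.normalCore = ⊥ := by
  refine ((disjoint_or_le_of_card_prime hK).resolve_right fun hle => hn ?_).eq_bot_of_le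
    K.normalCore_le
  rw [← K.normalCore_le.antisymm hle]
  exact K.normalCore_normal

theorem disjoint_normalCore_normalizer {p : ℕ} [Fact p.Prime] {P : Sylow p G} [Finite (Sylow p G)]
    (hP : Nat.card P = p) (hn : ¬(P : Subgroup G).Normal) :
    Disjoint (Subgroup.normalizer (P : Set G)).normalCore P := by
  refine (disjoint_or_le_of_card_prime (hP.symm ▸ Fact.out)).resolve_right fun hle => hn ?_
  -- Frattini: if `P` lies in the core `C` of its normalizer `N`, then `G = N ⊔ C = N`.
  have htop := Sylow.normalizer_sup_eq_top' P hle
  rw [sup_eq_left.2 (Subgroup.normalCore_le _)] at htop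
  exact Subgroup.normalizer_eq_top_iff.1 htop

theorem mem_alternatingGroup_of_index_ne_two {X : Type*} [Fintype X] [DecidableEq X]
    (h : ∀ K : Subgroup G, K.index ≠ 2) (f : G →* Perm X) (g : G) : f g ∈ alternatingGroup X := by
  have hdvd : (Perm.sign.comp f).ker.index ∣ 2 := by
    rw [Subgroup.index_ker, ← Nat.card_eq_fintype_card.trans (Fintype.card_units_int)]
    exact Subgroup.card_subgroup_dvd_card _
  have htop : (Perm.sign.comp f).ker = ⊤ :=
    Subgroup.index_eq_one.1 (((Nat.dvd_prime Nat.prime_two).1 hdvd).resolve_right (h _))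
  exact (Subgroup.eq_top_iff' _).1 htop g

variable {X : Type*} [Finite X] {n : ℕ}

theorem embedsInPerm_of_card_eq_factorial (hn : 4 ≤ n) (hX : Nat.card X = n + 1)
    (f : G →* Perm X) (hf : Function.Injective f) (hG : Nat.card G = n.factorial) :
    EmbedsInPerm n G := by
  have hcard : Nat.card (Perm X) = (n + 1) * Nat.card G := by
    rw [Nat.card_perm, hX, hG, Nat.factorial_succ]
  refine embedsInPerm_of_card_eq f hf hcard (normalCore_eq_bot_of_two_mul_card_lt (by omega) ?_)
  rw [← Nat.card_congr (MonoidHom.ofInjective hf).toEquiv, hcard, hG]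
  exact Nat.mul_lt_mul_of_pos_right (by omega) n.factorial_pos

theorem embedsInPerm_of_two_mul_card_eq_factorial (hn : 4 ≤ n) (hX : Nat.card X = n + 1)
    (f : G →* Perm X) (hf : Function.Injective f) (hG : 2 * Nat.card G = n.factorial)
    (hidx : ∀ K : Subgroup G, K.index ≠ 2) : EmbedsInPerm n G := by
  classical
  have := Fintype.ofFinite X
  have : Nontrivial X := Finite.one_lt_card_iff_nontrivial.1 (by omega)
  have : IsSimpleGroup (alternatingGroup X) := alternatingGroup.isSimpleGroup (by omega)
  have hf' : Function.Injective (f.codRestrict _ (mem_alternatingGroup_of_index_ne_two hidx f)) :=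
    fun a b hab => hf (congrArg Subtype.val hab)
  have hcard : Nat.card (alternatingGroup X) = (n + 1) * Nat.card G := by
    refine Nat.eq_of_mul_eq_mul_left two_pos ?_
    rw [two_mul_nat_card_alternatingGroup, Nat.card_perm, hX, Nat.factorial_succ, ← hG]
    ring
  refine embedsInPerm_of_card_eq _ hf' hcard (normalCore_eq_bot_of_isSimpleGroup fun htop => ?_)
  have hG' : Nat.card G = Nat.card (alternatingGroup X) := by
    rw [Nat.card_congr (MonoidHom.ofInjective hf').toEquiv, htop, Subgroup.card_top]
  have hpos : 0 < Nat.card G := by have := n.factorial_pos; omega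
  rw [hcard, eq_comm, Nat.mul_eq_right hpos.ne'] at hG'
  omega

end NormalCore

/-! ### Sylow subgroups -/

section Sylow

variable {G : Type*} [Group G]

theorem mul_card_le_of_disjoint {H K L : Subgroup G} [Finite L] (hH : H ≤ L) (hK : K ≤ L)
    (hHK : Disjoint H K) : Nat.card H * Nat.card K ≤ Nat.card L := by
  rw [← Nat.card_prod]
  refine Nat.card_le_card_of_injective
    (fun x : H × K => (⟨x.1 * x.2, mul_mem (hH x.1.2) (hK x.2.2)⟩ : L)) fun x y hxy => ?_
  exact Subgroup.mul_injective_of_disjoint hHK (congrArg Subtype.val hxy)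

theorem exists_mem_ne_one_pow_eq_one {K : Subgroup G} {n : ℕ} (hK : Nat.card K = n) (hn : 1 < n) :
    ∃ a ∈ K, a ≠ 1 ∧ a ^ n = 1 := by
  have : Finite K := Nat.finite_of_card_ne_zero (by omega)
  have : Nontrivial K := Finite.one_lt_card_iff_nontrivial.1 (hK.symm ▸ hn)
  obtain ⟨a, ha⟩ := exists_ne (1 : K)
  refine ⟨a, a.2, by simpa using ha, ?_⟩
  rw [← hK, ← SubmonoidClass.coe_pow, pow_card_eq_one', OneMemClass.coe_one]

theorem card_sylow_eq [Finite G] {p k m : ℕ} [hp : Fact p.Prime] (hG : Nat.card G = p ^ k * m)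
    (hm : ¬p ∣ m) (P : Sylow p G) : Nat.card P = p ^ k := by
  have hm0 : m ≠ 0 := fun h => hm (h ▸ dvd_zero p)
  rw [P.card_eq_multiplicity, hG, Nat.factorization_mul (pow_ne_zero k hp.out.ne_zero) hm0,
    Finsupp.add_apply, hp.out.factorization_pow, Finsupp.single_eq_same,
    Nat.factorization_eq_zero_of_not_dvd hm, add_zero]

theorem card_sylow_eq_prime [Finite G] {p : ℕ} [Fact p.Prime] (hp : p ∣ Nat.card G)
    (hp' : ¬p ^ 2 ∣ Nat.card G) (P : Sylow p G) : Nat.card P = p := by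
  obtain ⟨m, hm⟩ := hp
  rw [card_sylow_eq (k := 1) (m := m) (by rw [hm, pow_one]) (fun h => hp' ?_) P, pow_one]
  rw [hm, sq]
  exact mul_dvd_mul_left p h

theorem index_sylow_dvd [Finite G] {p k m : ℕ} [hp : Fact p.Prime]
    (hG : Nat.card G ∣ p ^ k * m) (P : Sylow p G) : (P : Subgroup G).index ∣ m :=
  (Nat.Coprime.pow_right k ((Nat.coprime_comm.1 (hp.out.coprime_iff_not_dvd.2
    P.not_dvd_index)))).dvd_of_dvd_mul_left ((P : Subgroup G).index_dvd_card.trans hG)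

theorem commute_of_le_normalizer_of_disjoint {P K : Subgroup G} [K.Normal]
    (h : Disjoint K P) (hK : K ≤ Subgroup.normalizer (P : Set G)) {m a : G}
    (hm : m ∈ K) (ha : a ∈ P) : Commute m a := by
  have hmem : m * a * m⁻¹ * a⁻¹ ∈ K := by
    simpa only [mul_assoc] using mul_mem hm (‹K.Normal›.conj_mem _ (inv_mem hm) a)
  have := Subgroup.disjoint_def.1 h hmem
    (mul_mem ((Subgroup.mem_normalizer_iff.1 (hK hm) a).1 ha) (inv_mem ha))
  rwa [mul_inv_eq_one, mul_inv_eq_iff_eq_mul] at this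

theorem commute_pow_of_card_prime {P : Subgroup G} [P.Normal] (hP : (Nat.card P).Prime) (g : G)
    {a : G} (ha : a ∈ P) : Commute (g ^ (Nat.card P - 1)) a := by
  have : Fact (Nat.card P).Prime := ⟨hP⟩
  have : Finite P := Nat.finite_of_card_ne_zero hP.ne_zero
  have : IsCyclic P := isCyclic_of_prime_card rfl
  have hconj : MulAut.conjNormal (H := P) (g ^ (Nat.card P - 1)) = 1 := by
    rw [map_pow, ← Nat.totient_prime hP, ← IsCyclic.card_mulAut, pow_card_eq_one']
  have := congrArg Subtype.val (DFunLike.congr_fun hconj (⟨a, ha⟩ : P))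
  rw [MulAut.conjNormal_apply] at this
  exact mul_inv_eq_iff_eq_mul.1 this

theorem card_normalizer_dvd {P : Subgroup G} (hP : (Nat.card P).Prime)
    (hcent : Subgroup.centralizer (P : Set G) ≤ P) :
    Nat.card (Subgroup.normalizer (P : Set G)) ∣ Nat.card P * (Nat.card P - 1) := by
  have : Fact (Nat.card P).Prime := ⟨hP⟩
  have : Finite P := Nat.finite_of_card_ne_zero hP.ne_zero
  have : IsCyclic P := isCyclic_of_prime_card rfl
  rw [← Subgroup.card_mul_index P.normalizerMonoidHom.ker, Subgroup.index_ker,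
    Subgroup.normalizerMonoidHom_ker]
  refine mul_dvd_mul ?_ ?_
  · rw [← Nat.card_congr (Subgroup.subgroupOfEquivOfLe P.le_normalizer).toEquiv]
    exact Subgroup.card_dvd_of_le fun _ hg => hcent hg
  · rw [← Nat.totient_prime hP, ← IsCyclic.card_mulAut]
    exact Subgroup.card_subgroup_dvd_card _

theorem pow_mem_zpowers_of_mem_zpowers {p k : ℕ} (hp : p.Prime) {c z : G}
    (hc : c ^ p ^ (k + 1) = 1) (hz : z ∈ Subgroup.zpowers c) (hz' : z ≠ 1) :
    c ^ p ^ k ∈ Subgroup.zpowers z := by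
  obtain ⟨i, rfl⟩ := hz
  have hmem : c ^ Int.gcd i ↑(p ^ (k + 1)) ∈ Subgroup.zpowers (c ^ i) := by
    rw [← zpow_natCast, Int.gcd_eq_gcd_ab, zpow_add, zpow_mul, zpow_mul, zpow_natCast, hc,
      one_zpow, mul_one]
    exact Subgroup.zpow_mem_zpowers _ _
  obtain ⟨j, hj, hgcd⟩ := (Nat.dvd_prime_pow hp).1
    (Int.natCast_dvd_natCast.1 (Int.gcd_dvd_right i ↑(p ^ (k + 1))))
  rw [hgcd] at hmem
  have hjk : j ≤ k := by
    by_contra! hlt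
    obtain ⟨d, hd⟩ := Int.gcd_dvd_left i ↑(p ^ (k + 1))
    rw [hgcd, hj.antisymm hlt] at hd
    exact hz' (by simp only [hd, zpow_mul, zpow_natCast, hc, one_zpow])
  rw [← Nat.add_sub_of_le hjk, pow_add, pow_mul]
  exact pow_mem hmem _

end Sylow

/-! ### Models of order divisible by five -/

namespace IsModel

variable {G : Type*} [Group G]

theorem mem_zpowers_of_commute (h : IsModel G) {a b : G} (hb : b ^ 5 = 1) (hb' : b ≠ 1)
    (hab : Commute a b) : a ∈ Subgroup.zpowers b := by
  have pow_five_or_twelve (c : G) : c ^ 5 = 1 ∨ c ^ 12 = 1 := by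
    rcases (exists_mem_exponents456 fun _ => c).1 (h.exponents456 _) with hc | hc | hc
    · exact .inr (by rw [pow_mul c 4 3, hc, one_pow])
    · exact .inl hc
    · exact .inr (by rw [pow_mul c 6 2, hc, one_pow])
  have ha : a ^ 5 = 1 := by
    rcases pow_five_or_twelve (a * b) with hm | hm <;> rw [hab.mul_pow] at hm
    · rwa [hb, mul_one] at hm
    refine (pow_five_or_twelve a).resolve_right fun ha => hb' ?_
    rw [ha, one_mul] at hm
    exact eq_one_of_pow_eq_one_of_coprime (by decide) hb hm
  refine mem_zpowers_of_pow_five h.order25 hb hb' fun n => ?_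
  rw [(hab.pow_right n).mul_pow, ha, one_mul, pow_right_comm, hb, one_pow]

theorem mem_of_forall_commute (h : IsModel G) {P : Subgroup G} (hP : Nat.card P = 5) {g : G}
    (hg : ∀ a ∈ P, Commute g a) : g ∈ P := by
  obtain ⟨a, haP, ha, ha'⟩ := exists_mem_ne_one_pow_eq_one hP (by decide)
  exact Subgroup.zpowers_le.2 haP (h.mem_zpowers_of_commute ha' ha (hg a haP))

theorem eq_bot_of_le_normalizer_of_disjoint (h : IsModel G) {P K : Subgroup G} [K.Normal]
    (hP : Nat.card P = 5) (hKP : Disjoint K P) (hK : K ≤ Subgroup.normalizer (P : Set G)) :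
    K = ⊥ := by
  refine hKP.eq_bot_of_le fun m hm => h.mem_of_forall_commute hP fun a ha => ?_
  exact commute_of_le_normalizer_of_disjoint hKP hK hm ha

variable [Finite G]

theorem card_sylow_five (h : IsModel G) (h5 : 5 ∣ Nat.card G) (P : Sylow 5 G) :
    Nat.card P = 5 :=
  have : Fact (Nat.Prime 5) := ⟨Nat.prime_five⟩
  card_sylow_eq_prime h5 (fun h25 => absurd (h25.trans h.card_dvd) (by decide)) P

theorem normal_or_index_normalizer_eq_six (h : IsModel G) {P : Sylow 5 G} (hP : Nat.card P = 5) :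
    (P : Subgroup G).Normal ∧ Nat.card G ∣ 20 ∨
      (Subgroup.normalizer (P : Set G)).index = 6 ∧
        (Nat.card G = 30 ∨ Nat.card G = 60 ∨ Nat.card G = 120) := by
  have : Fact (Nat.Prime 5) := ⟨Nat.prime_five⟩
  set N := Subgroup.normalizer (P : Set G) with hN
  have hNcard : Nat.card N ∣ 20 := by
    have := card_normalizer_dvd (P := (P : Subgroup G)) (hP.symm ▸ Nat.prime_five) fun g hg =>
      h.mem_of_forall_commute hP fun a ha => (Subgroup.mem_centralizer_iff.1 hg a ha).symm
    rwa [hP] at this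
  have hidx : N.index = 1 ∨ N.index = 6 := by
    have hdvd : N.index ∣ 24 := by
      rw [hN, ← P.card_eq_index_normalizer]
      exact P.card_dvd_index.trans (index_sylow_dvd (k := 1) h.card_dvd P)
    have hmod : N.index % 5 = 1 := by
      rw [hN, ← P.card_eq_index_normalizer]
      exact card_sylow_modEq_one 5 G
    have : ∀ n ∈ Nat.divisors 24, n % 5 = 1 → n = 1 ∨ n = 6 := by decide
    exact this _ (Nat.mem_divisors.2 ⟨hdvd, by decide⟩) hmod
  rw [← Subgroup.card_mul_index N]
  rcases hidx with hidx | hidx <;> rw [hidx]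
  · exact .inl ⟨Subgroup.normalizer_eq_top_iff.1 (Subgroup.index_eq_one.1 hidx), by rwa [mul_one]⟩
  · have h5 : 5 ∣ Nat.card N := hP ▸ Subgroup.card_dvd_of_le Subgroup.le_normalizer
    have : ∀ m ∈ Nat.divisors 20, 5 ∣ m → m * 6 = 30 ∨ m * 6 = 60 ∨ m * 6 = 120 := by decide
    exact .inr ⟨rfl, this _ (Nat.mem_divisors.2 ⟨hNcard, by decide⟩) h5⟩

theorem card_ne_fifteen (h : IsModel G) : Nat.card G ≠ 15 := by
  intro hG
  obtain ⟨P⟩ := (inferInstance : Nonempty (Sylow 5 G))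
  rcases h.normal_or_index_normalizer_eq_six (h.card_sylow_five (hG ▸ by decide) P) with h | h
  · exact absurd (hG ▸ h.2) (by decide)
  · omega

theorem card_ne_thirty (h : IsModel G) : Nat.card G ≠ 30 := by
  intro hG
  obtain ⟨Q⟩ := (inferInstance : Nonempty (Sylow 2 G))
  have hQ : Nat.card Q = 2 := card_sylow_eq_prime (hG ▸ by decide) (hG ▸ by decide) Q
  -- Burnside's transfer gives a normal complement of order 15.
  have hcompl := IsCyclic.isComplement' (P := Q) (by rw [hG]; decide) (isCyclic_of_prime_card hQ)
  have hcard := hcompl.card_mul_card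
  rw [hQ] at hcard
  exact (h.subgroup _).card_ne_fifteen (Nat.eq_of_mul_eq_mul_right two_pos (hcard.trans hG))

theorem embedsInPerm_of_sylow_five_normal (h : IsModel G) {P : Sylow 5 G} (hP : Nat.card P = 5)
    (hnormal : (P : Subgroup G).Normal) (hG : Nat.card G ∣ 20) : EmbedsInPerm 5 G := by
  have : Fact (Nat.Prime 5) := ⟨Nat.prime_five⟩
  obtain ⟨Q⟩ := (inferInstance : Nonempty (Sylow 2 G))
  have hdisj : Disjoint (Q : Subgroup G).normalCore P :=
    (IsPGroup.disjoint_of_ne 2 5 (by decide) _ _ Q.2 P.2).mono_left (Subgroup.normalCore_le _)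
  have hcore : (Q : Subgroup G).normalCore = ⊥ :=
    h.eq_bot_of_le_normalizer_of_disjoint hP hdisj
      (Subgroup.normalizer_eq_top_iff.2 hnormal ▸ le_top)
  exact embedsInPerm_of_index_le hcore
    (Nat.le_of_dvd (by decide) (index_sylow_dvd (k := 2) (m := 5) hG Q))

theorem embedsInPerm_of_five_dvd_card (h : IsModel G) (h5 : 5 ∣ Nat.card G) :
    EmbedsInPerm 5 G := by
  have : Fact (Nat.Prime 5) := ⟨Nat.prime_five⟩
  obtain ⟨P⟩ := (inferInstance : Nonempty (Sylow 5 G))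
  have hP := h.card_sylow_five h5 P
  rcases h.normal_or_index_normalizer_eq_six hP with ⟨hnormal, hG⟩ | ⟨hidx, hG⟩
  · exact h.embedsInPerm_of_sylow_five_normal hP hnormal hG
  have hnormal : ¬(P : Subgroup G).Normal := fun hnormal =>
    absurd (hidx.symm.trans
      (Subgroup.index_eq_one.2 (Subgroup.normalizer_eq_top_iff.2 hnormal))) (by decide)
  have hcore : (Subgroup.normalizer (P : Set G)).normalCore = ⊥ :=
    h.eq_bot_of_le_normalizer_of_disjoint hP (disjoint_normalCore_normalizer hP hnormal)
      (Subgroup.normalCore_le _)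
  have := faithfulSMul_quotient hcore
  have hinj := MulAction.toPerm_injective (α := G) (β := G ⧸ Subgroup.normalizer (P : Set G))
  rcases hG with hG | hG | hG
  · exact absurd hG h.card_ne_thirty
  · refine embedsInPerm_of_two_mul_card_eq_factorial (by decide) hidx (MulAction.toPermHom G _)
      hinj (by rw [hG]; rfl) fun K hK => (h.subgroup K).card_ne_thirty ?_
    have := Subgroup.card_mul_index K
    rw [hK, hG] at this
    omega
  · exact embedsInPerm_of_card_eq_factorial (by decide) hidx (MulAction.toPermHom G _) hinj hG

end IsModel

/-! ### Models of order dividing 24 -/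

section

variable {G : Type*} [Group G]

theorem pow_eq_one_of_mul_pow_eq_one {a b : G} (hab : Commute a b) {m n k : ℕ}
    (hmn : m.Coprime n) (ha : a ^ m = 1) (hb : b ^ n = 1) (h : (a * b) ^ k = 1) :
    a ^ k = 1 ∧ b ^ k = 1 := by
  rw [hab.mul_pow] at h
  have hak : a ^ k = 1 := by
    refine eq_one_of_pow_eq_one_of_coprime hmn ?_ ?_
    · rw [pow_right_comm, ha, one_pow]
    · rw [eq_inv_of_mul_eq_one_left h, inv_pow, pow_right_comm, hb, one_pow, inv_one]
  exact ⟨hak, by rwa [hak, one_mul] at h⟩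

variable [Finite G]

theorem embedsInPerm_of_card_dvd_pow_mul_pow {p q k l : ℕ} [Fact p.Prime] [Fact q.Prime]
    (hpq : p ≠ q) (hG : Nat.card G ∣ p ^ k * q ^ l) : EmbedsInPerm (p ^ k + q ^ l) G := by
  obtain ⟨P⟩ := (inferInstance : Nonempty (Sylow p G))
  obtain ⟨Q⟩ := (inferInstance : Nonempty (Sylow q G))
  have hPQ : Disjoint (Q : Subgroup G) P := IsPGroup.disjoint_of_ne q p hpq.symm _ _ Q.2 P.2
  refine embedsInPerm_of_index_add_index_le
    (hPQ.mono (Subgroup.normalCore_le _) (Subgroup.normalCore_le _)) (add_le_add ?_ ?_)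
  · exact Nat.le_of_dvd (pow_pos (Fact.out : p.Prime).pos k)
      (index_sylow_dvd (mul_comm (p ^ k) _ ▸ hG) Q)
  · exact Nat.le_of_dvd (pow_pos (Fact.out : q.Prime).pos l) (index_sylow_dvd hG P)

theorem index_normalizer_eq_four {P : Sylow 3 G} (hP : ¬(P : Subgroup G).Normal)
    (hG : Nat.card G ∣ 24) : (Subgroup.normalizer (P : Set G)).index = 4 := by
  have hdvd : (Subgroup.normalizer (P : Set G)).index ∣ 8 := by
    rw [← P.card_eq_index_normalizer]
    exact P.card_dvd_index.trans (index_sylow_dvd (k := 1) hG P)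
  have hmod : (Subgroup.normalizer (P : Set G)).index % 3 = 1 := by
    rw [← P.card_eq_index_normalizer]
    exact card_sylow_modEq_one 3 G
  have : ∀ n ∈ Nat.divisors 8, n % 3 = 1 → n = 1 ∨ n = 4 := by decide
  exact (this _ (Nat.mem_divisors.2 ⟨hdvd, by decide⟩) hmod).resolve_left fun h =>
    hP (Subgroup.normalizer_eq_top_iff.1 (Subgroup.index_eq_one.1 h))

end

namespace IsModel

variable {G : Type*} [Group G]

theorem not_commute_sq (h : IsModel G) {a c : G} (hc : c ^ 4 = 1) (hc' : c ^ 2 ≠ 1)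
    (ha : a ^ 3 = 1) (ha' : a ≠ 1) : ¬Commute (c ^ 2) a := by
  intro hca
  have pow_eq_one {n : ℕ} (hn : (c ^ 2 * a ^ 2) ^ n = 1) : (c ^ 2) ^ n = 1 ∧ (a ^ 2) ^ n = 1 :=
    pow_eq_one_of_mul_pow_eq_one (hca.pow_right 2) (m := 2) (n := 3) (by decide)
      (by rw [← pow_mul, hc]) (by rw [pow_right_comm, ha, one_pow]) hn
  have a_eq_one {n : ℕ} (hn : Nat.Coprime 3 n) (h : a ^ n = 1) : a = 1 :=
    eq_one_of_pow_eq_one_of_coprime hn ha h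
  rcases (exists_mem_dicyclic12 _).1 (h.dicyclic12 fun n => if n = 1 then c else a) with
    h | h | h | h | h | h | h
  · exact hc' (pow_eq_pow_mod 10 hc ▸ h)
  · exact ha' (a_eq_one (by decide) h)
  · exact ha' (a_eq_one (by decide) ((show c ^ 4 = a ^ 4 from h) ▸ hc))
  · have h : c ^ 6 = a ^ 6 := h
    rw [pow_eq_pow_mod 6 hc, pow_eq_pow_mod 6 ha] at h
    exact hc' (h.trans (pow_zero a))
  · have h : (c ^ 2) ^ 3 = 1 := (pow_eq_one h).1
    rw [← pow_mul, pow_eq_pow_mod _ hc] at h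
    exact hc' h
  · exact ha' (a_eq_one (by decide) ((pow_mul a 2 4).trans (pow_eq_one h).2))
  · exact ha' (a_eq_one (by decide) ((pow_mul a 2 5).trans (pow_eq_one h).2))

theorem eq_of_commute_of_sq_eq_one (h : IsModel G) {a s t : G} (ha : a ^ 3 = 1) (ha' : a ≠ 1)
    (hs : s ^ 2 = 1) (hs' : s ≠ 1) (ht : t ^ 2 = 1) (ht' : t ≠ 1) (has : Commute a s)
    (hat : Commute a t) (hst : Commute s t) : s = t := by
  have pow_eq_one {b u : G} {n : ℕ} (hb : b ^ 3 = 1) (hu : u ^ 2 = 1) (hbu : Commute b u)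
      (hn : (b * u) ^ n = 1) : b ^ n = 1 ∧ u ^ n = 1 :=
    pow_eq_one_of_mul_pow_eq_one hbu (by decide) hb hu hn
  have a_eq_one {n : ℕ} (hn : Nat.Coprime 3 n) (h : a ^ n = 1) : a = 1 :=
    eq_one_of_pow_eq_one_of_coprime hn ha h
  have hprod : a * s * (a * t) = a ^ 2 * (s * t) := by
    rw [mul_assoc, ← mul_assoc s, ← has.eq, sq, mul_assoc, mul_assoc]
  have hstsq : (s * t) ^ 2 = 1 := by rw [hst.mul_pow, hs, ht, one_mul]
  have pow_eq_one_prod {n : ℕ} (hn : (a * s * (a * t)) ^ n = 1) :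
      (a ^ 2) ^ n = 1 ∧ (s * t) ^ n = 1 :=
    pow_eq_one (by rw [pow_right_comm, ha, one_pow]) hstsq ((has.mul_right hat).pow_left 2)
      (hprod ▸ hn)
  have eq_one {u : G} (hu : u ^ 2 = 1) (h : u ^ 15 = 1) : u = 1 :=
    eq_one_of_pow_eq_one_of_coprime (by decide) hu h
  rcases (exists_mem_abelian12 _).1 (h.abelian12 fun n => if n = 1 then a * s else a * t) with
    h | h | h | h | h | h
  · exact absurd (eq_one hs (pow_eq_one ha hs has h).2) hs'
  · exact absurd (eq_one ht (pow_eq_one ha ht hat h).2) ht'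
  · exact absurd (a_eq_one (by decide) (pow_eq_one ha hs has h).1) ha'
  · exact absurd (a_eq_one (by decide) (pow_eq_one ha ht hat h).1) ha'
  · rw [mul_eq_one_iff_eq_inv.1 (eq_one hstsq (pow_eq_one_prod h).2)]
    exact inv_eq_of_mul_eq_one_left (by rw [← sq, ht])
  · exact absurd (a_eq_one (by decide) ((pow_mul a 2 4).trans (pow_eq_one_prod h).1)) ha'

theorem eq_one_of_commute_of_commute (h : IsModel G) {a c z : G} (hc : c ^ 4 = 1)
    (hc' : c ^ 2 ≠ 1) (ha : a ^ 3 = 1) (ha' : a ≠ 1) (hz : z ^ 2 = 1) (hzc : Commute z c)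
    (hza : Commute z a) : z = 1 := by
  by_contra hz'
  have hmul (n : ℕ) : (z * c * c ^ n) ^ 4 = 1 := by
    rw [mul_assoc, ← pow_succ', (hzc.pow_right _).mul_pow, pow_mul z 2 2, hz, one_pow, one_mul,
      pow_right_comm, hc, one_pow]
  have hmem : z * c ∈ Subgroup.zpowers c :=
    mem_zpowers_of_pow_four h.fourCycles (by rwa [hzc.mul_pow, hz, one_mul]) hc hc' hmul
  have hmem' : c ^ 2 ∈ Subgroup.zpowers z :=
    pow_mem_zpowers_of_mem_zpowers (k := 1) Nat.prime_two hc
      ((Subgroup.mul_mem_cancel_right _ (Subgroup.mem_zpowers c)).1 hmem) hz'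
  obtain ⟨i, hi⟩ := hmem'
  exact h.not_commute_sq hc hc' ha ha' (hi ▸ hza.zpow_left i)

theorem pow_four_eq_one_of_card_eq_eight (h : IsModel G) (hG : Nat.card G = 8) (a : G) :
    a ^ 4 = 1 :=
  pow_eq_one_of_isPGroup (p := 2) (m := 15) (IsPGroup.of_card (n := 3) hG) (by decide)
    (pow_sixty_eq_one h.exponents456 a)

theorem exists_sq_ne_one_of_card_eq_eight (h : IsModel G) (hG : Nat.card G = 8) :
    ∃ c : G, c ^ 2 ≠ 1 := by
  by_contra! hsq
  have := card_le_four_of_sq_eq_one h.elementaryAbelian8 hsq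
  omega

theorem embedsInPerm_of_card_eq_eight (h : IsModel G) (hG : Nat.card G = 8) :
    EmbedsInPerm 5 G := by
  have : Finite G := Nat.finite_of_card_ne_zero (by omega)
  have hfour := h.pow_four_eq_one_of_card_eq_eight hG
  obtain ⟨c, hc⟩ := h.exists_sq_ne_one_of_card_eq_eight hG
  have hsq : ∀ b ∉ Subgroup.zpowers c, b ^ 2 = 1 := fun b hb => of_not_not fun hb' =>
    hb (mem_zpowers_of_pow_four h.fourCycles hb' (hfour c) hc fun _ => hfour _)
  obtain ⟨b, hb⟩ : ∃ b, b ∉ Subgroup.zpowers c := by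
    by_contra! htop
    have hdvd := orderOf_dvd_of_pow_eq_one (hfour c)
    rw [orderOf_eq_card_of_forall_mem_zpowers htop, hG] at hdvd
    exact absurd hdvd (by decide)
  have hcard : Nat.card (Subgroup.zpowers b) = 2 := by
    rw [Nat.card_zpowers]
    exact orderOf_eq_prime (hsq b hb) fun h => hb (h ▸ one_mem _)
  refine embedsInPerm_of_index_le
    (normalCore_eq_bot_of_card_prime (hcard.symm ▸ Nat.prime_two) fun hnormal => ?_) ?_
  · have hbc := commute_pow_of_card_prime (hcard.symm ▸ Nat.prime_two) c (Subgroup.mem_zpowers b)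
    rw [hcard, pow_one] at hbc
    have hinv := conj_eq_inv_of_forall_sq_eq_one hsq hb
    rw [← hbc.eq, mul_inv_cancel_right, eq_inv_iff_mul_eq_one, ← sq] at hinv
    exact hc hinv
  · have := Subgroup.card_mul_index (Subgroup.zpowers b)
    rw [hcard, hG] at this
    omega

end IsModel

/-! ### Classification of the finite models -/

section

variable {G : Type*} [Group G]

theorem disjoint_sup_of_disjoint_centralizer {P K V : Subgroup G} [P.Normal] [K.Normal]
    [IsMulCommutative P] (hKP : Disjoint K P)
    (hV : Disjoint (Subgroup.centralizer (P : Set G)) V) : Disjoint K (P ⊔ V) := by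
  rw [Subgroup.disjoint_def] at hKP hV ⊢
  intro m hmK hmPV
  obtain ⟨u, hu, v, hv, rfl⟩ := Subgroup.mem_sup_of_normal_left.1 hmPV
  have hmcent : u * v ∈ Subgroup.centralizer (P : Set G) := Subgroup.mem_centralizer_iff.2
    fun a ha => (Subgroup.commute_of_normal_of_disjoint P K ‹_› ‹_›
      (Subgroup.disjoint_def.2 fun hP hK => hKP hK hP) a (u * v) ha hmK).eq
  have hucent := Subgroup.le_centralizer P hu
  have hv1 := hV ((Subgroup.mul_mem_cancel_left _ hucent).1 hmcent) hv
  rw [hv1, mul_one] at hmK ⊢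
  exact hKP hmK hu

end

namespace IsModel

variable {G : Type*} [Group G]

theorem sq_eq_one_of_pow_four_eq_one (h : IsModel G) {P : Subgroup G} [P.Normal]
    (hP : Nat.card P = 3) {c : G} (hc : c ^ 4 = 1) : c ^ 2 = 1 := by
  by_contra hc'
  obtain ⟨a, haP, ha', ha⟩ := exists_mem_ne_one_pow_eq_one hP (by decide)
  have := commute_pow_of_card_prime (hP.symm ▸ Nat.prime_three) c haP
  rw [hP] at this
  exact h.not_commute_sq hc hc' ha ha' this

theorem exists_mem_notMem_centralizer (h : IsModel G) {P Q : Subgroup G} (hP : Nat.card P = 3)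
    (hQ : Nat.card Q = 4) (hsq : ∀ s ∈ Q, s ^ 2 = 1) :
    ∃ s ∈ Q, s ∉ Subgroup.centralizer (P : Set G) := by
  by_contra! hcent
  obtain ⟨a, haP, ha', ha⟩ := exists_mem_ne_one_pow_eq_one hP (by decide)
  have commute_a (s : Q) : Commute a s := Subgroup.mem_centralizer_iff.1 (hcent s s.2) a haP
  have hsq' (s : Q) : s ^ 2 = 1 := Subtype.ext (hsq s s.2)
  have hcomm (s t : Q) : Commute s t :=
    Commute.of_orderOf_dvd_two (fun s => orderOf_dvd_of_pow_eq_one (hsq' s)) s t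
  have hdvd : Nat.card Q ∣ 2 := card_dvd_prime_of_forall_mem_zpowers hsq' fun s t ht => by
    by_cases hs : s = 1
    · exact hs ▸ one_mem _
    have hst := h.eq_of_commute_of_sq_eq_one ha ha' (hsq s s.2) (by simpa using hs) (hsq t t.2)
      (by simpa using ht) (commute_a s) (commute_a t) (congrArg Subtype.val (hcomm s t).eq)
    exact Subtype.ext hst ▸ Subgroup.mem_zpowers s
  rw [hQ] at hdvd
  exact absurd hdvd (by decide)

variable [Finite G]

theorem embedsInPerm_of_card_eq_twelve_of_normal (h : IsModel G) (hG : Nat.card G = 12)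
    {P : Subgroup G} [P.Normal] (hP : Nat.card P = 3) : EmbedsInPerm 5 G := by
  obtain ⟨Q⟩ := (inferInstance : Nonempty (Sylow 2 G))
  have hQ : Nat.card Q = 4 := card_sylow_eq (k := 2) (m := 3) hG (by decide) Q
  have hsq : ∀ s ∈ (Q : Subgroup G), s ^ 2 = 1 := fun s hs =>
    h.sq_eq_one_of_pow_four_eq_one hP
      (orderOf_dvd_iff_pow_eq_one.1 (hQ ▸ Subgroup.orderOf_dvd_natCard _ hs))
  obtain ⟨s, hs, hscent⟩ := h.exists_mem_notMem_centralizer hP hQ hsq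
  have hscard : Nat.card (Subgroup.zpowers s) = 2 := by
    rw [Nat.card_zpowers]
    exact orderOf_eq_prime (hsq s hs) fun hs1 => hscent (hs1 ▸ one_mem _)
  have hQP : Disjoint (Q : Subgroup G) P := by
    refine Subgroup.disjoint_of_coprime_natCard ?_
    rw [hQ, hP]
    decide
  have hcent : Disjoint (Subgroup.centralizer (P : Set G)) (Subgroup.zpowers s) :=
    (disjoint_or_le_of_card_prime (hscard.symm ▸ Nat.prime_two)).resolve_right fun hle =>
      hscent (hle (Subgroup.mem_zpowers s))
  have : IsCyclic P := isCyclic_of_prime_card (p := 3) hP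
  have hL := mul_card_le_of_disjoint (L := P ⊔ Subgroup.zpowers s) le_sup_left le_sup_right
    (hcent.mono_left (Subgroup.le_centralizer P))
  refine embedsInPerm_of_index_add_index_le (K := Q) (L := P ⊔ Subgroup.zpowers s)
    ((disjoint_sup_of_disjoint_centralizer (hQP.mono_left (Subgroup.normalCore_le _))
      hcent).mono_right (Subgroup.normalCore_le _)) ?_
  have hQidx := Subgroup.card_mul_index (Q : Subgroup G)
  have hLidx := Subgroup.card_mul_index (P ⊔ Subgroup.zpowers s)
  rw [hQ, hG] at hQidx
  rw [hP, hscard] at hL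
  rw [hG] at hLidx
  have : (P ⊔ Subgroup.zpowers s).index ≤ 2 := by nlinarith
  omega

theorem embedsInPerm_of_card_eq_twelve (h : IsModel G) (hG : Nat.card G = 12) :
    EmbedsInPerm 5 G := by
  obtain ⟨P⟩ := (inferInstance : Nonempty (Sylow 3 G))
  have hP : Nat.card P = 3 := card_sylow_eq_prime (hG ▸ by decide) (hG ▸ by decide) P
  by_cases hnormal : (P : Subgroup G).Normal
  · exact h.embedsInPerm_of_card_eq_twelve_of_normal hG hP
  refine embedsInPerm_of_index_le
    (normalCore_eq_bot_of_card_prime (hP.symm ▸ Nat.prime_three) hnormal) ?_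
  have hidx := Subgroup.card_mul_index (P : Subgroup G)
  rw [hP, hG] at hidx
  omega

theorem eq_bot_of_card_le_two (h : IsModel G) {P K : Subgroup G} [K.Normal]
    (hP : Nat.card P = 3) (hK : Nat.card K ≤ 2) (hKP : Disjoint K P)
    (hKN : K ≤ Subgroup.normalizer (P : Set G)) {c : G} (hc : c ^ 4 = 1) (hc' : c ^ 2 ≠ 1) :
    K = ⊥ := by
  by_contra hne
  have hK2 : Nat.card K = 2 := hK.antisymm ((Subgroup.one_lt_card_iff_ne_bot K).2 hne)
  obtain ⟨a, haP, ha', ha⟩ := exists_mem_ne_one_pow_eq_one hP (by decide)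
  obtain ⟨z, hzK, hz', hz⟩ := exists_mem_ne_one_pow_eq_one hK2 (by decide)
  have hcz := commute_pow_of_card_prime (hK2.symm ▸ Nat.prime_two) c hzK
  rw [hK2, pow_one] at hcz
  exact hz' (h.eq_one_of_commute_of_commute hc hc' ha ha' hz hcz.symm
    (commute_of_le_normalizer_of_disjoint hKP hKN hzK haP))

theorem embedsInPerm_of_card_eq_twentyFour (h : IsModel G) (hG : Nat.card G = 24) :
    EmbedsInPerm 5 G := by
  obtain ⟨P⟩ := (inferInstance : Nonempty (Sylow 3 G))
  obtain ⟨Q⟩ := (inferInstance : Nonempty (Sylow 2 G))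
  have hP : Nat.card P = 3 := card_sylow_eq_prime (hG ▸ by decide) (hG ▸ by decide) P
  have hQ : Nat.card Q = 8 := card_sylow_eq (k := 3) (m := 3) hG (by decide) Q
  obtain ⟨⟨c, hcQ⟩, hc'⟩ := (h.subgroup Q).exists_sq_ne_one_of_card_eq_eight hQ
  have hc : c ^ 4 = 1 := congrArg Subtype.val
    ((h.subgroup Q).pow_four_eq_one_of_card_eq_eight hQ ⟨c, hcQ⟩)
  replace hc' : c ^ 2 ≠ 1 := fun hc => hc' (Subtype.ext hc)
  have hnormal : ¬(P : Subgroup G).Normal := fun _ =>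
    hc' (h.sq_eq_one_of_pow_four_eq_one hP hc)
  have hidx := index_normalizer_eq_four hnormal hG.dvd
  have hdisj := disjoint_normalCore_normalizer hP hnormal
  have hle := (Subgroup.normalizer (P : Set G)).normalCore_le
  refine embedsInPerm_of_index_le (h.eq_bot_of_card_le_two hP ?_ hdisj hle hc hc')
    (hidx.trans_le (by decide))
  have hmul := mul_card_le_of_disjoint hle Subgroup.le_normalizer hdisj
  have hcard := Subgroup.card_mul_index (Subgroup.normalizer (P : Set G))
  rw [hG, hidx] at hcard
  rw [hP] at hmul
  omega

theorem embedsInPerm (h : IsModel G) : EmbedsInPerm 5 G := by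
  by_cases h5 : 5 ∣ Nat.card G
  · exact h.embedsInPerm_of_five_dvd_card h5
  have h24 : Nat.card G ∣ 24 :=
    ((Nat.prime_five.coprime_iff_not_dvd.2 h5).symm).dvd_of_dvd_mul_left h.card_dvd
  have : ∀ n ∈ Nat.divisors 24, n ≤ 5 ∨ n ∣ 2 ^ 1 * 3 ^ 1 ∨ n = 8 ∨ n = 12 ∨ n = 24 := by decide
  rcases this _ (Nat.mem_divisors.2 ⟨h24, by decide⟩) with hG | hG | hG | hG | hG
  · exact embedsInPerm_of_card_le hG
  · exact embedsInPerm_of_card_dvd_pow_mul_pow (by decide) hG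
  · exact h.embedsInPerm_of_card_eq_eight hG
  · exact h.embedsInPerm_of_card_eq_twelve hG
  · exact h.embedsInPerm_of_card_eq_twentyFour hG

end IsModel

end DisjunctiveIdentity

open DisjunctiveIdentity in
theorem theorem2_general {n : ℕ} (hn : 120 ≤ n) :
    IsBasisOfDIdentities.{0, v} (Equiv.Perm (Fin 5))
      {omega n, exponents456, fourCycles, elementaryAbelian8, order9, abelian12, dicyclic12,
        order25} := by
  refine ⟨?_, fun H _ hH δ hδ => ?_⟩
  · have card_le : Nat.card (Equiv.Perm (Fin 5)) ≤ n := by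
      rw [Nat.card_perm, Nat.card_fin]
      exact hn
    rintro δ (rfl | rfl | rfl | rfl | rfl | rfl | rfl | rfl)
    exacts [satisfies_omega_of_card_le card_le, satisfies_exponents456, satisfies_fourCycles,
      satisfies_elementaryAbelian8, satisfies_order9, satisfies_abelian12, satisfies_dicyclic12,
      satisfies_order25]
  · have : Finite H := (hH (omega n) (by simp)).finite_of_omega
    have model : IsModel H := by constructor <;> exact hH _ (by simp)
    obtain ⟨f, hf⟩ := model.embedsInPerm
    exact hδ.of_injective hf

theorem theorem2 :
    DisjunctiveIdentity.IsBasisOfDIdentities.{0, v} (Equiv.Perm (Fin 5))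
      {DisjunctiveIdentity.omega 120,
        DisjunctiveIdentity.exponents456,
        DisjunctiveIdentity.fourCycles,
        DisjunctiveIdentity.elementaryAbelian8,
        DisjunctiveIdentity.order9,
        DisjunctiveIdentity.abelian12,
        DisjunctiveIdentity.dicyclic12,
        DisjunctiveIdentity.order25} :=
  theorem2_general le_rfl
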